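/- \textbf{Theorem (quantum soundness of the KCVY protocol).} \emph{Model.} Write $\{0,1\}^m$ for bit strings of length $m$, $x\oplus x'$ for bitwise exclusive or and $r\cdot x$ for the inner product modulo $2$. A function $\nu:\mathbb N\to[0,\infty)$ is \emph{negligible} if $\nu(\lambda)p(\lambda)\to 0$ for every polynomial $p$. Fix for each security parameter $\lambda$ an initial state: a unit vector on polynomially many qubits held by the quantum machine and a finite-dimensional environment on which nobody acts (it may be trivial). A \emph{quantum polynomial-time} machine is a non-uniform family of polynomial-size quantum circuits over the Clifford+T gates that starts from this initial state and an all-zero workspace; in each round it receives a classical message, applies a circuit, and measures an output register to obtain its reply. \emph{Trapdoor claw-free functions.} Let $\mathcal F$ be a post-quantum trapdoor claw-free function family, with keys, trapdoors, domains $\mathcal X_k\subseteq\{0,1\}^n$, $n=n(\lambda)$, and functions $f_k:\mathcal X_k\to\{0,1\}^{\ell}$, $\ell=\ell(\lambda)$, all strings being of polynomial length. That is: (1) a probabilistic polynomial-time algorithm $\mathrm{Gen}(1^\lambda)$ generates a key and trapdoor $(k,t_k)$; (2) for every generated $(k,t_k)$ there is a perfect matching $R_k$ on $\mathcal X_k$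 such that $f_k(x_0)=f_k(x_1)$ for $(x_0,x_1)\in R_k$, and a deterministic polynomial-time algorithm $\mathrm{Inv}$ satisfies $\mathrm{Inv}(t_k,y)=(x_0,x_1)$ whenever $(x_0,x_1)\in R_k$ and $y=f_k(x_0)=f_k(x_1)$, and $\mathrm{Inv}(t_k,y)=\bot$ if $y\notin f_k(\mathcal X_k)$; (3) for every quantum polynomial-time machine $\mathcal A$ (with the fixed initial states), the probability over $(k,t_k)\leftarrow\mathrm{Gen}(1^\lambda)$ and the measurement that $\mathcal A(k)$ outputs $x_0\ne x_1$ in $\mathcal X_k$ with $f_k(x_0)=f_k(x_1)$ is negligible; (4) a uniform polynomial-time quantum algorithm prepares $|\mathcal X_k|^{-1/2}\sum_{x\in\mathcal X_k}|x\rangle|f_k(x)\rangle$ from $k$, up to a negligible error. \emph{Protocol.} The verifier samples $(k,t_k)\leftarrow\mathrm{Gen}(1^\lambda)$ and sends $k$; the prover replies with $y\in\{0,1\}^\ell$. The verifier computes $\mathrm{Inv}(t_k,y)$ (if this is $\bot$ it rejects in both tests below; otherwise let it be $(x_0,x_1)$) and carries out one of two tests, each with probability $\frac12$. \emph{Preimage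 test:} it asks for a preimage, the prover replies with $x\in\{0,1\}^n$, and the verifier accepts iff $x\in\{x_0,x_1\}$. \emph{Equation test:} it sends a uniformly random $r\in\{0,1\}^n$, the prover replies with $d\in\{0,1\}^n$; it sends a uniformly random $m\in\{0,1\}$, the prover replies with $b\in\{0,1\}$; the verifier accepts iff $(-1)^b=\hat c_m$, where $\hat c_m=(-1)^{r\cdot x_0}$ if $r\cdot(x_0\oplus x_1)=0$, and $\hat c_m=(-1)^{d\cdot(x_0\oplus x_1)}(-1)^m$ if $r\cdot(x_0\oplus x_1)=1$. \emph{Claim.} Suppose that a quantum polynomial-time prover (with the fixed initial states) is accepted with probability $1-\kappa(\lambda)$ when the preimage test is chosen, and with probability $q(\lambda)$ when the equation test is chosen. Then there is a negligible function $\nu$ such that for all $\lambda$ \[ q(\lambda)\;\le\;\cos^2\frac{\pi}{8}+\frac{\sqrt{\kappa(\lambda)}}{2}+\nu(\lambda)\;.\] -/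

import Mathlib

open scoped BigOperators

noncomputable section

/-! ## Asymptotics -/

/-- `g : ℕ → ℕ` is bounded by a polynomial. -/
def PolyBounded (g : ℕ → ℕ) : Prop :=
  ∃ p : Polynomial ℕ, ∀ l, g l ≤ p.eval l

/-- A negligible function: nonnegative, and decaying faster than every inverse polynomial. -/
def Negligible (ν : ℕ → ℝ) : Prop :=
  (∀ l, 0 ≤ ν l) ∧ Asymptotics.SuperpolynomialDecay Filter.atTop (fun l : ℕ => (l : ℝ)) ν

/-! ## Bit strings and classical polynomial time -/

/-- Strings of `n` bits. -/
abbrev Bits (n : ℕ) : Type := Fin n → Bool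

/-- Bitwise exclusive or. -/
def Bits.xor {n : ℕ} (x y : Bits n) : Bits n := fun i => x i ^^ y i

/-- Inner product modulo 2. -/
def Bits.dot {n : ℕ} (x y : Bits n) : ZMod 2 := ∑ i, if x i && y i then 1 else 0

/-- `1^l`, in unary. -/
def unary (l : ℕ) : List Bool := List.replicate l true

/-- A self-delimiting injective encoding of a pair of strings. -/
def pairCode (u v : List Bool) : List Bool := u.flatMap (fun b => [true, b]) ++ false :: v

/-- A string function computed by a deterministic polynomial-time Turing machine. -/
def PolyTime (g : List Bool → List Bool) : Prop :=
  Nonempty (Turing.TM2ComputableInPolyTime (id : List Bool → List Bool)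
    (id : List Bool → List Bool) g)

/-! ## Quantum circuits

A state of the qubits labelled by `W`, possibly entangled with an environment whose Hilbert space
is `E`, is a vector of `(ℂ²)^{⊗ W} ⊗ E`. It is given by its coefficients, i.e. by a function
`(W → Bool) → E`; for `E = ℂ` this is an ordinary pure state of the qubits `W`. -/

/-- States of the qubits `W` together with an environment `E`. -/
abbrev QState (W E : Type) : Type := (W → Bool) → E

/-- Elementary gates (Clifford + T). -/
inductive Gate (W : Type) : Type
  | had (i : W)
  | not (i : W)
  | t (i : W)
  | tdg (i : W)
  | cnot (control target : W) (h : control ≠ target)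

/-- A circuit is a list of gates, the head being applied first; its size is its length. -/
abbrev Circuit (W : Type) : Type := List (Gate W)

/-- Action of a gate: Hadamard, `X`, `T = diag(1, e^{iπ/4})`, `T†`, controlled-not.
It acts trivially on the environment. -/
def Gate.apply {W E : Type} [DecidableEq W] [AddCommGroup E] [Module ℂ E] :
    Gate W → QState W E → QState W E
  | .had i, ψ => fun z => (((√2 : ℝ) : ℂ)⁻¹) •
      (ψ (Function.update z i false) + (if z i then (-1 : ℂ) else 1) • ψ (Function.update z i true))
  | .not i, ψ => fun z => ψ (Function.update z i (!z i))
  | .t i, ψ => fun z => (if z i then Complex.exp (Complex.I * (Real.pi / 4)) else 1) • ψ z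
  | .tdg i, ψ => fun z => (if z i then Complex.exp (-(Complex.I * (Real.pi / 4))) else 1) • ψ z
  | .cnot i j _, ψ => fun z => ψ (Function.update z j (z j ^^ z i))

/-- The unitary implemented by a circuit. -/
def Circuit.run {W E : Type} [DecidableEq W] [AddCommGroup E] [Module ℂ E]
    (C : Circuit W) (ψ : QState W E) : QState W E :=
  C.foldl (fun φ g => g.apply φ) ψ

/-- Squared norm of a (possibly subnormalized) state. -/
def normSq {W E : Type} [Fintype W] [DecidableEq W] [NormedAddCommGroup E]
    (ψ : QState W E) : ℝ := ∑ z, ‖ψ z‖ ^ 2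

/-- `ψ ⊗ |s⟩`: adjoin a register `A` in the computational basis state `s`. -/
def attachReg {W A E : Type} [Fintype A] [DecidableEq A] [Zero E]
    (ψ : QState W E) (s : A → Bool) : QState (W ⊕ A) E :=
  fun z => if (fun a => z (Sum.inr a)) = s then ψ (fun w => z (Sum.inl w)) else 0

/-- One round of interaction of a quantum machine with memory `W`. It receives the classical
message `msg` in a fresh register `A`, is given a fresh register `B` in the all-zero state, applies
the circuit `C`, and measures the register `B` in the computational basis. The result is the
unnormalized post-measurement state for the outcome `reply`; its squared norm, when `ψ` is
itself such an unnormalized state, is the joint probability of all the outcomes so far. -/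
def playRound {W A B E : Type} [DecidableEq W] [Fintype A] [DecidableEq A] [Fintype B] [DecidableEq B]
    [AddCommGroup E] [Module ℂ E] (C : Circuit (W ⊕ (A ⊕ B))) (msg : A → Bool) (reply : B → Bool)
    (ψ : QState W E) : QState (W ⊕ (A ⊕ B)) E :=
  fun z => if (fun b => z (Sum.inr (Sum.inr b))) = reply
    then C.run (attachReg ψ (Sum.elim msg (fun _ => false))) z else 0

/-- A sequence of initial states available to a quantum machine at security parameter `l`: a unit
vector on polynomially many qubits held by the machine and an environment of arbitrary finite
dimension that nobody acts on. With `qubits = 0` and `envDim = 1` it is trivial, and the machines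
below are ordinary polynomial-size families of quantum circuits. -/
structure InitialState where
  qubits : ℕ → ℕ
  envDim : ℕ → ℕ
  state : (l : ℕ) → QState (Fin (qubits l)) (EuclideanSpace ℂ (Fin (envDim l)))
  norm_one : ∀ l, normSq (state l) = 1
  poly : PolyBounded qubits

/-- The memory of a machine at the start: its part of the initial state and a workspace. -/
abbrev Memory (S : InitialState) (work : ℕ → ℕ) (l : ℕ) : Type := Fin (S.qubits l) ⊕ Fin (work l)

/-- The workspace starts in the all-zero state. -/
def InitialState.memory (S : InitialState) (work : ℕ → ℕ) (l : ℕ) :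
    QState (Memory S work l) (EuclideanSpace ℂ (Fin (S.envDim l))) :=
  attachReg (S.state l) (fun _ => false)

/-! ## Trapdoor claw-free functions -/

/-- The data of a trapdoor claw-free function family. For the security parameter `l`, the key and
trapdoor are `gen l ω`, where `ω` are the uniformly random coins of the generation algorithm;
`f l k` maps the domain `X l k ⊆ {0,1}^{n l}` to strings of `yLen l` bits (its values outside of
`X l k` are irrelevant); `inv l t y` is the output of the inversion algorithm, `none` meaning that
it reports that `y` has no preimage. -/
structure TCFData where
  coinLen : ℕ → ℕ
  keyLen : ℕ → ℕ
  trapLen : ℕ → ℕ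
  n : ℕ → ℕ
  yLen : ℕ → ℕ
  gen : (l : ℕ) → Bits (coinLen l) → Bits (keyLen l) × Bits (trapLen l)
  X : (l : ℕ) → Bits (keyLen l) → Finset (Bits (n l))
  f : (l : ℕ) → Bits (keyLen l) → Bits (n l) → Bits (yLen l)
  inv : (l : ℕ) → Bits (trapLen l) → Bits (yLen l) → Option (Bits (n l) × Bits (n l))

/-- `R` is a perfect matching on `X`: its pairs consist of two distinct elements of `X`, and every
element of `X` lies in exactly one of them. -/
def IsPerfectMatching {α : Type} (X : Finset α) (R : Set (α × α)) : Prop :=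
  (∀ p ∈ R, p.1 ∈ X ∧ p.2 ∈ X ∧ p.1 ≠ p.2) ∧ ∀ x ∈ X, ∃! p, p ∈ R ∧ (p.1 = x ∨ p.2 = x)

namespace TCFData

variable (F : TCFData)

/-- Encoding of the output of the inversion algorithm. -/
def invCode {n : ℕ} : Option (Bits n × Bits n) → List Bool
  | none => [false]
  | some p => true :: pairCode (List.ofFn p.1) (List.ofFn p.2)

/-- `Gen(1^l)` runs in probabilistic polynomial time. -/
def EfficientGeneration : Prop :=
  (∃ p : Polynomial ℕ, ∀ l, F.coinLen l = p.eval l) ∧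
  ∃ g, PolyTime g ∧ ∀ l (ω : Bits (F.coinLen l)),
    g (pairCode (unary l) (List.ofFn ω)) =
      pairCode (List.ofFn (F.gen l ω).1) (List.ofFn (F.gen l ω).2)

/-- All strings involved have polynomial length. -/
def PolyLengths : Prop :=
  PolyBounded F.coinLen ∧ PolyBounded F.keyLen ∧ PolyBounded F.trapLen ∧ PolyBounded F.n ∧
    PolyBounded F.yLen

/-- For every generated key, the domain is perfectly matched into claws, and the trapdoor inverts:
it returns the claw of every image, and `none` on every string that is not an image. -/
def InjectivePairs : Prop :=
  ∀ l (ω : Bits (F.coinLen l)), ∃ R : Set (Bits (F.n l) × Bits (F.n l)),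
    IsPerfectMatching (F.X l (F.gen l ω).1) R ∧
    (∀ p ∈ R, F.f l (F.gen l ω).1 p.1 = F.f l (F.gen l ω).1 p.2 ∧
      F.inv l (F.gen l ω).2 (F.f l (F.gen l ω).1 p.1) = some p) ∧
    (∀ y, (∀ x ∈ F.X l (F.gen l ω).1, F.f l (F.gen l ω).1 x ≠ y) →
      F.inv l (F.gen l ω).2 y = none)

/-- The inversion algorithm is deterministic polynomial time. -/
def EfficientInversion : Prop :=
  ∃ g, PolyTime g ∧ ∀ l (ω : Bits (F.coinLen l)) (y : Bits (F.yLen l)),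
    g (pairCode (unary l) (pairCode (List.ofFn (F.gen l ω).2) (List.ofFn y))) =
      invCode (F.inv l (F.gen l ω).2 y)

/-- Encoding of a gate, given a numbering of the qubits. -/
def gateCode {W : Type} (e : W → ℕ) : Gate W → List Bool
  | .had i => [false, false, false] ++ unary (e i) ++ [false]
  | .not i => [false, false, true] ++ unary (e i) ++ [false]
  | .t i => [false, true, false] ++ unary (e i) ++ [false]
  | .tdg i => [false, true, true] ++ unary (e i) ++ [false]
  | .cnot i j _ => [true, false, false] ++ unary (e i) ++ [false] ++ unary (e j) ++ [false]

/-- The registers of a circuit for the superposition: key, workspace, argument, value. -/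
abbrev SupWires (work : ℕ → ℕ) (l : ℕ) : Type :=
  (Fin (F.keyLen l) ⊕ Fin (work l)) ⊕ (Fin (F.n l) ⊕ Fin (F.yLen l))

/-- A numbering of these qubits. -/
def supIndex (work : ℕ → ℕ) (l : ℕ) : F.SupWires work l → ℕ :=
  Sum.elim (Sum.elim (fun i => 4 * i) (fun i => 4 * i + 1))
    (Sum.elim (fun i => 4 * i + 2) (fun i => 4 * i + 3))

open Classical in
/-- The state `|X_k|^{-1/2} ∑_{x ∈ X_k} |x⟩ |f_k(x)⟩`. -/
def clawState (l : ℕ) (k : Bits (F.keyLen l)) : QState (Fin (F.n l) ⊕ Fin (F.yLen l)) ℂ :=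
  fun z => if (fun i => z (Sum.inl i)) ∈ F.X l k ∧
      F.f l k (fun i => z (Sum.inl i)) = (fun j => z (Sum.inr j))
    then (((√((F.X l k).card : ℝ))⁻¹ : ℝ) : ℂ) else 0

/-- A uniform polynomial-time family of quantum circuits prepares `clawState` from the key, up to
a negligible error in norm; the key and workspace registers may end in any state `g`, as long as
they are not entangled with the result. -/
def EfficientSuperposition : Prop :=
  ∃ (work : ℕ → ℕ) (C : (l : ℕ) → Circuit (F.SupWires work l)),
    PolyBounded work ∧
    (∃ g, PolyTime g ∧ ∀ l, g (unary l) = (C l).flatMap (gateCode (F.supIndex work l))) ∧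
    ∃ ν, Negligible ν ∧ ∀ l (ω : Bits (F.coinLen l)),
      ∃ g : QState (Fin (F.keyLen l) ⊕ Fin (work l)) ℂ, normSq g = 1 ∧
        √(normSq (fun z : F.SupWires work l → Bool =>
          (C l).run (attachReg (attachReg (fun s : Bits (F.keyLen l) =>
              if s = (F.gen l ω).1 then (1 : ℂ) else 0) (fun _ => false)) (fun _ => false)) z
            - g (fun i => z (Sum.inl i)) *
              F.clawState l (F.gen l ω).1 (fun i => z (Sum.inr i)))) ≤ ν l

/-- A non-uniform quantum adversary against claw-freeness, starting from the initial states `S`: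
one round, with the key as input and a pair of strings as output. -/
structure ClawFinder (S : InitialState) where
  work : ℕ → ℕ
  circuit : (l : ℕ) →
    Circuit (Memory S work l ⊕ (Fin (F.keyLen l) ⊕ (Fin (F.n l) ⊕ Fin (F.n l))))

/-- The adversary has polynomial size. -/
def ClawFinder.IsPoly {F : TCFData} {S : InitialState} (A : F.ClawFinder S) : Prop :=
  PolyBounded A.work ∧ PolyBounded (fun l => (A.circuit l).length)

/-- `x₀ ≠ x₁` are elements of the domain with the same image under `f_k`. -/
def IsClaw (l : ℕ) (k : Bits (F.keyLen l)) (x₀ x₁ : Bits (F.n l)) : Prop :=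
  x₀ ∈ F.X l k ∧ x₁ ∈ F.X l k ∧ x₀ ≠ x₁ ∧ F.f l k x₀ = F.f l k x₁

open Classical in
/-- The probability, over the key and the measurement, that the adversary outputs a claw. -/
def ClawFinder.successProb {F : TCFData} {S : InitialState} (A : F.ClawFinder S) (l : ℕ) : ℝ :=
  𝔼 ω : Bits (F.coinLen l), ∑ x₀ : Bits (F.n l), ∑ x₁ : Bits (F.n l),
    if F.IsClaw l (F.gen l ω).1 x₀ x₁ then
      normSq (playRound (A.circuit l) (F.gen l ω).1 (Sum.elim x₀ x₁) (S.memory A.work l))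
    else 0

/-- Claw-freeness against polynomial-size quantum circuits with initial states `S`. -/
def ClawFree (S : InitialState) : Prop :=
  ∀ A : F.ClawFinder S, A.IsPoly → Negligible A.successProb

/-- `F` is a trapdoor claw-free function family, with claw-freeness holding against
polynomial-size quantum circuits with initial states `S`. -/
structure IsPostQuantumTCF (S : InitialState) : Prop where
  lengths : F.PolyLengths
  generation : F.EfficientGeneration
  pairs : F.InjectivePairs
  inversion : F.EfficientInversion
  clawFree : F.ClawFree S
  superposition : F.EfficientSuperposition

end TCFData

/-! ## The KCVY protocol -/

/-- The correct answer `ĉ_m ∈ {1, -1}` in the equation test. -/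
def correctAnswer {n : ℕ} (x₀ x₁ r d : Bits n) (m : Bool) : ℤ :=
  if r.dot (x₀.xor x₁) = 0 then (if r.dot x₀ = 0 then 1 else -1)
  else if d.dot (x₀.xor x₁) = 0 then (if m then -1 else 1)
  else (if m then 1 else -1)

/-- The verifier's decision in the preimage test, on the result of the inversion algorithm. -/
def preimageAccepts {n : ℕ} : Option (Bits n × Bits n) → Bits n → Prop
  | none, _ => False
  | some p, x => x = p.1 ∨ x = p.2

/-- The verifier's decision in the equation test, on the result of the inversion algorithm. -/
def equationAccepts {n : ℕ} : Option (Bits n × Bits n) → Bits n → Bits n → Bool → Bool → Prop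
  | none, _, _, _, _ => False
  | some p, r, d, m, b => (if b then (-1 : ℤ) else 1) = correctAnswer p.1 p.2 r d m

namespace TCFData

variable (F : TCFData)

/-- Memory of the prover after the first round: it has received the key and measured `y`. -/
abbrev Memory₁ (S : InitialState) (work : ℕ → ℕ) (l : ℕ) : Type :=
  Memory S work l ⊕ (Fin (F.keyLen l) ⊕ Fin (F.yLen l))

/-- Memory of the prover after having received `r` and measured `d`. -/
abbrev Memory₂ (S : InitialState) (work : ℕ → ℕ) (l : ℕ) : Type :=
  F.Memory₁ S work l ⊕ (Fin (F.n l) ⊕ Fin (F.n l))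

/-- A quantum prover. The circuits are its actions: on receiving the key (reply `y`), on receiving
the request for a preimage (reply `x`), on receiving `r` (reply `d`), on receiving `m`
(reply `b`). -/
structure Prover (S : InitialState) where
  work : ℕ → ℕ
  commit : (l : ℕ) → Circuit (Memory S work l ⊕ (Fin (F.keyLen l) ⊕ Fin (F.yLen l)))
  preimage : (l : ℕ) → Circuit (F.Memory₁ S work l ⊕ (Empty ⊕ Fin (F.n l)))
  equation : (l : ℕ) → Circuit (F.Memory₁ S work l ⊕ (Fin (F.n l) ⊕ Fin (F.n l)))
  answer : (l : ℕ) → Circuit (F.Memory₂ S work l ⊕ (Unit ⊕ Unit))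

namespace Prover

variable {F} {S : InitialState} (P : F.Prover S)

/-- The prover is polynomial time. -/
def IsPoly : Prop :=
  PolyBounded P.work ∧ PolyBounded (fun l => (P.commit l).length) ∧
    PolyBounded (fun l => (P.preimage l).length) ∧
    PolyBounded (fun l => (P.equation l).length) ∧ PolyBounded (fun l => (P.answer l).length)

/-- Unnormalized state after the first round, with key `k` and reply `y`. -/
def stateY (l : ℕ) (k : Bits (F.keyLen l)) (y : Bits (F.yLen l)) :
    QState (F.Memory₁ S P.work l) (EuclideanSpace ℂ (Fin (S.envDim l))) :=
  playRound (P.commit l) k y (S.memory P.work l)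

/-- Probability that, on key `k`, the prover replies `y` and then, being asked for a
preimage, `x`. -/
def probYX (l : ℕ) (k : Bits (F.keyLen l)) (y : Bits (F.yLen l)) (x : Bits (F.n l)) : ℝ :=
  normSq (playRound (P.preimage l) (fun e : Empty => e.elim) x (P.stateY l k y))

/-- Probability that, on key `k` and challenges `r`, `m` in the equation test, the prover replies
`y`, `d`, `b`. -/
def probYDB (l : ℕ) (k : Bits (F.keyLen l)) (r : Bits (F.n l)) (m : Bool)
    (y : Bits (F.yLen l)) (d : Bits (F.n l)) (b : Bool) : ℝ :=
  normSq (playRound (P.answer l) (fun _ : Unit => m) (fun _ : Unit => b)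
    (playRound (P.equation l) r d (P.stateY l k y)))

open Classical in
/-- Probability that the verifier accepts, given that it chose the preimage test. -/
def preimageProb (l : ℕ) : ℝ :=
  𝔼 ω : Bits (F.coinLen l), ∑ y : Bits (F.yLen l), ∑ x : Bits (F.n l),
    if preimageAccepts (F.inv l (F.gen l ω).2 y) x then P.probYX l (F.gen l ω).1 y x else 0

open Classical in
/-- Probability that the verifier accepts, given that it chose the equation test. -/
def equationProb (l : ℕ) : ℝ :=
  𝔼 ω : Bits (F.coinLen l), 𝔼 r : Bits (F.n l), 𝔼 m : Bool,
    ∑ y : Bits (F.yLen l), ∑ d : Bits (F.n l), ∑ b : Bool,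
      if equationAccepts (F.inv l (F.gen l ω).2 y) r d m b then
        P.probYDB l (F.gen l ω).1 r m y d b
      else 0

end Prover

end TCFData

end

/-! Fix a key and a commitment `y` with claw `(x₀, x₁)`, and put `s = x₀ ⊕ x₁`. After the challenge
`r` and the reply `d`, the two possible final measurements are ±1 observables `B₀`, `B₁` on the
prover's state `φ` (with fresh zero qubits). The correct answers satisfy `c₁ = ε c₀` with `ε =
(-1)^{r·s}`. A Tsirelson-type sum of squares, `‖B₀φ + ε B₁φ - √2 c₀ φ‖² ≥ 0`, bounds the score by
`(1/2 + √2/4)‖φ‖² + (√2/8) ε Re⟨B₀φ, B₁φ⟩` (`equation_score_le`). Since `1/2 + √2/4 = cos²(π/8)`,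
only the sum over `y`, `d` and average over `r` of `(-1)^{r·s} Re⟨B₀φ, B₁φ⟩` has to be controlled.

This is a Fourier coefficient in `r`, and the Bernstein-Vazirani (quantum Goldreich-Levin) trick
turns it into an amplitude. Prepare a uniform superposition of `r`, run the equation test coherently
with a copy of `d` in place of its measurement, apply `B₁` and then `B₀⁻¹`, undo the test and the
Hadamard gates. The overlap of the result `Ω` with the undisturbed committed state tensored with
`|s⟩`, call it `τ`, has the sum above as its real part (`re_qinner_attackCorrelation`).

Now apply the prover's preimage circuit to both `Ω` and `τ`; the overlap is unchanged. Split the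
basis according to whether an accepted preimage is written next to `s`. By Cauchy-Schwarz, one part
is at most the square root of the probability that `Ω` yields an accepted preimage together with
`s`, hence a claw; the other is at most the square root of the probability that `τ`, which still
holds the honest committed state, yields a rejected preimage, and this is at most the failure
probability of the preimage test (`sum_correlation_le`).

So each key costs at most `(√2/8)(√clawProb + √failure)` above `cos²(π/8)` (`equationProbKey_le`).
Averaging over keys by concavity of the square root and invoking claw-freeness for the explicit
polynomial-size `clawFinder` finishes the proof. -/

noncomputable section

set_option linter.unusedSectionVars false
set_option synthInstance.maxSize 2048
set_option synthInstance.maxHeartbeats 200000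

/-! ## The algebra of circuits -/

section Circuits

variable {W W' A E : Type} [DecidableEq W] [DecidableEq W']

/-- The inverse of a gate. -/
def Gate.inv : Gate W → Gate W
  | .had i => .had i
  | .not i => .not i
  | .t i => .tdg i
  | .tdg i => .t i
  | .cnot i j h => .cnot i j h

/-- The inverse of a circuit. -/
def Circuit.inv (C : Circuit W) : Circuit W := (List.map Gate.inv C).reverse

/-- Relabelling the wires of a gate. -/
def Gate.rename (e : W ↪ W') : Gate W → Gate W'
  | .had i => .had (e i)
  | .not i => .not (e i)
  | .t i => .t (e i)
  | .tdg i => .tdg (e i)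
  | .cnot i j h => .cnot (e i) (e j) (fun h' => h (e.injective h'))

/-- Relabelling the wires of a circuit. -/
def Circuit.rename (e : W ↪ W') (C : Circuit W) : Circuit W' := List.map (Gate.rename e) C

@[simp] lemma Circuit.length_inv (C : Circuit W) : C.inv.length = C.length := by
  simp [Circuit.inv]

@[simp] lemma Circuit.length_rename (e : W ↪ W') (C : Circuit W) :
    (C.rename e).length = C.length := by
  simp [Circuit.rename]

section Module

variable [AddCommGroup E] [Module ℂ E]

@[simp] lemma Circuit.run_nil (ψ : QState W E) : Circuit.run ([] : Circuit W) ψ = ψ := rfl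

lemma Circuit.run_cons (g : Gate W) (C : Circuit W) (ψ : QState W E) :
    Circuit.run (g :: C) ψ = Circuit.run C (g.apply ψ) := rfl

lemma Circuit.run_append (C D : Circuit W) (ψ : QState W E) :
    Circuit.run (C ++ D) ψ = Circuit.run D (Circuit.run C ψ) := by
  simp [Circuit.run, List.foldl_append]

lemma inv_sqrt_two_mul_self : (((√2 : ℝ) : ℂ)⁻¹) * (((√2 : ℝ) : ℂ)⁻¹) = 2⁻¹ := by
  rw [← mul_inv, ← Complex.ofReal_mul, Real.mul_self_sqrt (by norm_num)]
  norm_num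

lemma Gate.apply_inv_apply (g : Gate W) (ψ : QState W E) : g.inv.apply (g.apply ψ) = ψ := by
  cases g with
  | had i =>
    funext z
    simp only [Gate.inv, Gate.apply, Function.update_self, Function.update_idem]
    have h : ∀ b, z i = b → Function.update z i b = z := by rintro b rfl; simp
    have hc := inv_sqrt_two_mul_self
    cases hz : z i <;> conv_rhs => rw [← h _ hz]
    all_goals
      simp only [Bool.false_eq_true, if_true, if_false, one_smul, smul_add, smul_smul, hc]
      set c := (((√2 : ℝ) : ℂ)⁻¹)
      match_scalars <;> first | ring1 | linear_combination hc | linear_combination -hc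
  | not i => funext z; simp [Gate.inv, Gate.apply]
  | t i =>
    funext z
    simp only [Gate.inv, Gate.apply]
    split_ifs <;> simp [smul_smul, ← Complex.exp_add]
  | tdg i =>
    funext z
    simp only [Gate.inv, Gate.apply]
    split_ifs <;> simp [smul_smul, ← Complex.exp_add]
  | cnot i j h =>
    funext z
    simp [Gate.inv, Gate.apply, Function.update_of_ne h]

lemma Gate.inv_inv (g : Gate W) : g.inv.inv = g := by cases g <;> rfl

lemma Circuit.inv_inv (C : Circuit W) : C.inv.inv = C := by
  simp [Circuit.inv, List.map_reverse, Function.comp_def, Gate.inv_inv]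

lemma Circuit.run_inv_run (C : Circuit W) (ψ : QState W E) :
    Circuit.run C.inv (Circuit.run C ψ) = ψ := by
  induction C generalizing ψ with
  | nil => rfl
  | cons g C ih =>
    have : Circuit.inv (g :: C) = Circuit.inv C ++ [g.inv] := by simp [Circuit.inv]
    rw [this, Circuit.run_append, Circuit.run_cons g C, ih]
    exact Gate.apply_inv_apply g ψ

lemma Circuit.run_run_inv (C : Circuit W) (ψ : QState W E) :
    Circuit.run C (Circuit.run C.inv ψ) = ψ := by
  simpa [Circuit.inv_inv] using Circuit.run_inv_run C.inv ψ

lemma Gate.apply_smul (g : Gate W) (c : ℂ) (ψ : QState W E) : g.apply (c • ψ) = c • g.apply ψ := by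
  cases g <;> funext z <;> simp only [Gate.apply, Pi.smul_apply] <;> module

lemma Circuit.run_smul (C : Circuit W) (c : ℂ) (ψ : QState W E) :
    C.run (c • ψ) = c • C.run ψ := by
  induction C generalizing ψ with
  | nil => rfl
  | cons g C ih => rw [Circuit.run_cons, Circuit.run_cons, Gate.apply_smul, ih]

lemma Circuit.run_zero (C : Circuit W) : C.run (0 : QState W E) = 0 := by
  simpa using Circuit.run_smul C (0 : ℂ) (0 : QState W E)

lemma update_extend (e : W ↪ W') (w : W → Bool) (z : W' → Bool) (i : W) (b : Bool) :
    Function.update (Function.extend e w z) (e i) b =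
      Function.extend e (Function.update w i b) z := by
  funext j
  by_cases hj : ∃ i', e i' = j
  · obtain ⟨i', rfl⟩ := hj
    rw [e.injective.extend_apply]
    by_cases h : i' = i
    · subst h; simp
    · rw [Function.update_of_ne (fun h' => h (e.injective h')), e.injective.extend_apply,
        Function.update_of_ne h]
  · rw [Function.update_of_ne (fun h' => hj ⟨i, h'.symm⟩), Function.extend_apply' _ _ _ hj,
      Function.extend_apply' _ _ _ hj]

/-- A circuit on some of the wires acts on each slice of a state. -/
lemma Gate.apply_rename_extend (e : W ↪ W') (g : Gate W) (χ : QState W' E) (w : W → Bool)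
    (z : W' → Bool) :
    (g.rename e).apply χ (Function.extend e w z) =
      g.apply (fun w => χ (Function.extend e w z)) w := by
  cases g <;> simp [Gate.rename, Gate.apply, update_extend, e.injective.extend_apply]

lemma Circuit.run_rename_extend (e : W ↪ W') (C : Circuit W) (χ : QState W' E) (w : W → Bool)
    (z : W' → Bool) :
    (C.rename e).run χ (Function.extend e w z) =
      C.run (fun w => χ (Function.extend e w z)) w := by
  induction C generalizing χ with
  | nil => rfl
  | cons g C ih =>
    show Circuit.run (Circuit.rename e C) ((g.rename e).apply χ) _ = _
    rw [ih, Circuit.run_cons]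
    congr 1
    funext w
    exact Gate.apply_rename_extend e g χ w z

lemma extend_comp_self (e : W ↪ W') (z : W' → Bool) : Function.extend e (z ∘ e) z = z := by
  funext j
  by_cases hj : ∃ i', e i' = j
  · obtain ⟨i', rfl⟩ := hj
    rw [e.injective.extend_apply]; rfl
  · rw [Function.extend_apply' _ _ _ hj]

/-- Wires outside the range of `e` are spectators: for each fixed value of them the circuit acts on
the slice as it would on `W` alone. -/
lemma Circuit.run_rename (e : W ↪ W') (C : Circuit W) (χ : QState W' E) (z : W' → Bool) :
    (C.rename e).run χ z = C.run (fun w => χ (Function.extend e w z)) (z ∘ e) := by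
  rw [← Circuit.run_rename_extend, extend_comp_self]

lemma Circuit.run_rename_equiv (e : W ≃ W') (C : Circuit W) (χ : QState W' E) (z : W' → Bool) :
    (C.rename e.toEmbedding).run χ z = C.run (fun w => χ (w ∘ e.symm)) (z ∘ e) := by
  rw [Circuit.run_rename]
  have : ∀ w : W → Bool, Function.extend e.toEmbedding w z = w ∘ e.symm := by
    intro w
    funext j
    obtain ⟨i, rfl⟩ := e.surjective j
    simp [e.injective.extend_apply]
  simp only [this]
  rfl

/-! ### Copying a register -/

/-- Add the register `a` to the register `b`, bit by bit. -/
def copyCircuit {m : ℕ} (a b : Fin m → W) (h : ∀ i j, a i ≠ b j) : Circuit W :=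
  (List.finRange m).map (fun i => Gate.cnot (a i) (b i) (h i i))

@[simp] lemma length_copyCircuit {m : ℕ} (a b : Fin m → W) (h : ∀ i j, a i ≠ b j) :
    (copyCircuit a b h).length = m := by simp [copyCircuit]

/-- No control is ever a target and each target occurs once, so the gates do not influence one
another. -/
lemma run_map_cnot {m : ℕ} (a b : Fin m → W) (hb : Function.Injective b) (h : ∀ i j, a i ≠ b j)
    (L : List (Fin m)) (hL : L.Nodup) (ψ : QState W E) (z : W → Bool) :
    Circuit.run (L.map (fun i => Gate.cnot (a i) (b i) (h i i))) ψ z =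
      ψ (Function.extend b (fun i => if i ∈ L then z (b i) ^^ z (a i) else z (b i)) z) := by
  induction L generalizing ψ z with
  | nil =>
    simp only [List.map_nil, Circuit.run_nil, List.not_mem_nil, if_false]
    exact congrArg ψ (extend_comp_self ⟨b, hb⟩ z).symm
  | cons i L ih =>
    rw [List.nodup_cons] at hL
    rw [List.map_cons, Circuit.run_cons, ih hL.2]
    simp only [Gate.apply]
    congr 1
    have ha : ¬ ∃ j, b j = a i := fun ⟨j, hj⟩ => h i j hj.symm
    have := update_extend ⟨b, hb⟩ (fun i => if i ∈ L then z (b i) ^^ z (a i) else z (b i)) z i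
    simp only [Function.Embedding.coeFn_mk] at this
    rw [this, hb.extend_apply, Function.extend_apply' _ _ _ ha, if_neg hL.1]
    congr 1
    funext j
    by_cases hj : j = i
    · subst hj; simp
    · rw [Function.update_of_ne hj]
      simp [hj]

/-- With a zero target that is left alone afterwards, this stands in for a measurement of the source
register: branches with different values can no longer interfere. -/
lemma run_copyCircuit {m : ℕ} (a b : Fin m → W) (hb : Function.Injective b)
    (h : ∀ i j, a i ≠ b j) (ψ : QState W E) (z : W → Bool) :
    (copyCircuit a b h).run ψ z = ψ (Function.extend b (fun i => z (b i) ^^ z (a i)) z) := by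
  rw [copyCircuit, run_map_cnot a b hb h _ (List.nodup_finRange m)]
  simp

/-! ### Hadamard gates on a register -/

/-- The sign `(-1)^{x · y}`. -/
def dotSign {m : ℕ} (x y : Bits m) : ℂ := ∏ i, if x i && y i then -1 else 1

/-- Hadamard gates on every qubit of a register. -/
def hadCircuit (m : ℕ) : Circuit (Fin m) := (List.finRange m).map Gate.had

@[simp] lemma length_hadCircuit (m : ℕ) : (hadCircuit m).length = m := by simp [hadCircuit]

/-- The list is reversed so that the induction adds the gate that acts last. Qubits whose gate has
not acted yet still hold their bit of `s`, hence the support condition. -/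
lemma run_map_had {m : ℕ} (s : Bits m) (v : E) (L : List (Fin m)) (hL : L.Nodup) (z : Bits m) :
    Circuit.run (L.reverse.map Gate.had) (fun z : Bits m => if z = s then v else 0) z =
      if ∀ i ∉ L, z i = s i then
        ((((√2 : ℝ) : ℂ)⁻¹) ^ L.length * (L.map fun i => if z i && s i then (-1 : ℂ) else 1).prod) • v
      else 0 := by
  induction L generalizing z with
  | nil => simp [funext_iff]
  | cons i L ih =>
    rw [List.nodup_cons] at hL
    rw [List.reverse_cons, List.map_append, Circuit.run_append]
    simp only [List.map_cons, List.map_nil, Circuit.run_cons, Circuit.run_nil, Gate.apply]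
    rw [ih hL.2, ih hL.2]
    have hp : ∀ b, (L.map fun j => if Function.update z i b j && s j then (-1 : ℂ) else 1) =
        L.map fun j => if z j && s j then (-1 : ℂ) else 1 := by
      intro b
      refine List.map_congr_left fun j hj => ?_
      rw [Function.update_of_ne (fun h : j = i => hL.1 (h ▸ hj))]
    -- Of the two terms of the new Hadamard gate, only the one with `b = s i` is supported.
    have hc : ∀ b, (∀ j ∉ L, Function.update z i b j = s j) ↔
        (b = s i ∧ ∀ j ∉ i :: L, z j = s j) := by
      intro b
      constructor
      · intro h
        refine ⟨by simpa using h i hL.1, fun j hj => ?_⟩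
        simp only [List.mem_cons, not_or] at hj
        simpa [Function.update_of_ne hj.1] using h j hj.2
      · rintro ⟨h1, h2⟩ j hj
        by_cases hji : j = i
        · subst hji; simpa using h1
        · rw [Function.update_of_ne hji]
          exact h2 j (by simp [hji, hj])
    simp only [hp, hc]
    by_cases h : ∀ j ∉ i :: L, z j = s j
    · simp only [List.prod_cons, List.length_cons, pow_succ]
      cases hs : s i <;> cases hz : z i <;> simp [smul_smul] <;> ring_nf
    · simp only [h, and_false, if_false, smul_zero, add_zero]

lemma run_hadCircuit {m : ℕ} (s : Bits m) (v : E) (z : Bits m) :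
    (hadCircuit m).run (fun z : Bits m => if z = s then v else 0) z =
      ((((√2 : ℝ) : ℂ)⁻¹) ^ m * dotSign z s) • v := by
  have := run_map_had s v (List.finRange m).reverse (List.nodup_reverse.2 (List.nodup_finRange m)) z
  rw [List.reverse_reverse] at this
  rw [hadCircuit, this, if_pos (by simp)]
  congr 2
  · simp
  · rw [dotSign, List.map_reverse, List.prod_reverse, ← List.prod_ofFn, List.ofFn_eq_map]

end Module

/-! ### Inner products -/

section Inner

variable [Fintype W] [Fintype W'] [NormedAddCommGroup E] [InnerProductSpace ℂ E]

/-- The inner product of two states. -/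
def qinner (φ ψ : QState W E) : ℂ := ∑ z, inner ℂ (φ z) (ψ z)

lemma qinner_self (ψ : QState W E) : qinner ψ ψ = normSq ψ := by
  simp [qinner, normSq, inner_self_eq_norm_sq_to_K]

lemma normSq_nonneg (ψ : QState W E) : 0 ≤ normSq ψ := Finset.sum_nonneg fun _ _ => by positivity

/-- A Hadamard gate mixes the two strings that differ at `i`; summing over such pairs, each counted
twice, lets unitarity be checked pair by pair. -/
lemma sum_update_bool {M : Type*} [AddCommMonoid M] (i : W) (f : (W → Bool) → M) :
    ∑ z, (f (Function.update z i false) + f (Function.update z i true)) = ∑ z, f z + ∑ z, f z := by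
  let e : (W → Bool) ≃ (W → Bool) := Function.Involutive.toPerm
    (fun z => Function.update z i (!z i)) (fun z => by simp)
  conv_rhs => arg 2; rw [← Equiv.sum_comp e]
  rw [← Finset.sum_add_distrib]
  refine Finset.sum_congr rfl fun z _ => ?_
  have h : ∀ b, z i = b → Function.update z i b = z := by rintro b rfl; simp
  show _ = f z + f (Function.update z i (!z i))
  cases hz : z i
  · rw [h _ hz]; rfl
  · rw [h _ hz, add_comm]; rfl

lemma Gate.qinner_apply (g : Gate W) (φ ψ : QState W E) :
    qinner (g.apply φ) (g.apply ψ) = qinner φ ψ := by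
  have hexp : ∀ x : ℝ, (starRingEnd ℂ) (Complex.exp (Complex.I * x)) = Complex.exp (-(Complex.I * x)) := by
    intro x
    rw [← Complex.exp_conj]; simp
  have hpi : (Real.pi / 4 : ℂ) = ((Real.pi / 4 : ℝ) : ℂ) := by push_cast; rfl
  have hpi' : -(Complex.I * (Real.pi / 4 : ℂ)) = Complex.I * ((-(Real.pi / 4) : ℝ) : ℂ) := by
    push_cast; ring
  cases g with
  | had i =>
    have h2 : ∀ x y : ℂ, x + x = y + y → x = y := fun x y h => by
      rw [← two_mul, ← two_mul] at h; exact mul_left_cancel₀ two_ne_zero h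
    apply h2
    simp only [qinner]
    rw [← sum_update_bool i, ← sum_update_bool i]
    refine Finset.sum_congr rfl fun z _ => ?_
    simp only [Gate.apply, Function.update_idem, Function.update_self, inner_smul_left,
      inner_smul_right, inner_add_left, inner_add_right, map_inv₀, Complex.conj_ofReal,
      Bool.false_eq_true, if_true, if_false, map_neg, map_one]
    have := inv_sqrt_two_mul_self
    set c := (((√2 : ℝ) : ℂ)⁻¹)
    linear_combination (2 * inner ℂ (φ (Function.update z i false)) (ψ (Function.update z i false)) + 2 * inner ℂ (φ (Function.update z i true)) (ψ (Function.update z i true))) * this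
  | not i =>
    exact Equiv.sum_comp (Function.Involutive.toPerm
      (fun z : W → Bool => Function.update z i (!z i)) (fun z => by simp))
      (fun z => inner ℂ (φ z) (ψ z))
  | t i =>
    refine Finset.sum_congr rfl fun z _ => ?_
    simp only [Gate.apply]
    split_ifs
    · rw [inner_smul_left, inner_smul_right, hpi, hexp, ← mul_assoc, ← Complex.exp_add]
      simp
    · simp
  | tdg i =>
    refine Finset.sum_congr rfl fun z _ => ?_
    simp only [Gate.apply]
    split_ifs
    · rw [inner_smul_left, inner_smul_right, hpi', hexp, ← mul_assoc, ← Complex.exp_add]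
      simp
    · simp
  | cnot i j h =>
    exact Equiv.sum_comp (Function.Involutive.toPerm
      (fun z : W → Bool => Function.update z j (z j ^^ z i))
      (fun z => by simp [Function.update_of_ne h]))
      (fun z => inner ℂ (φ z) (ψ z))

/-- Circuits are unitary. -/
lemma Circuit.qinner_run (C : Circuit W) (φ ψ : QState W E) :
    qinner (C.run φ) (C.run ψ) = qinner φ ψ := by
  induction C generalizing φ ψ with
  | nil => rfl
  | cons g C ih => rw [Circuit.run_cons, Circuit.run_cons, ih, Gate.qinner_apply]

lemma Circuit.normSq_run (C : Circuit W) (ψ : QState W E) : normSq (C.run ψ) = normSq ψ := by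
  have := Circuit.qinner_run C ψ ψ
  rw [qinner_self, qinner_self] at this
  exact_mod_cast this

lemma Circuit.qinner_run_inv (C : Circuit W) (φ ψ : QState W E) :
    qinner φ (C.inv.run ψ) = qinner (C.run φ) ψ := by
  rw [← Circuit.qinner_run C, Circuit.run_run_inv]

/-- The Cauchy-Schwarz inequality on part of the basis. -/
lemma sum_re_inner_le (s : Finset (W → Bool)) (φ ψ : QState W E) :
    ∑ z ∈ s, (inner ℂ (φ z) (ψ z)).re ≤ √(∑ z ∈ s, ‖φ z‖ ^ 2) * √(∑ z ∈ s, ‖ψ z‖ ^ 2) :=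
  (Finset.sum_le_sum fun z _ => re_inner_le_norm (𝕜 := ℂ) (φ z) (ψ z)).trans
    (Real.sum_mul_le_sqrt_mul_sqrt _ _ _)

lemma sum_sumElim {M : Type*} [AddCommMonoid M] (f : (W ⊕ W' → Bool) → M) :
    ∑ z, f z = ∑ b, ∑ a, f (Sum.elim a b) := by
  rw [Finset.sum_comm, ← Fintype.sum_prod_type' (f := fun a b => f (Sum.elim a b)),
    ← Equiv.sum_comp (Equiv.sumArrowEquivProdArrow W W' Bool).symm]
  rfl

omit [InnerProductSpace ℂ E] in
lemma normSq_attachReg (ψ : QState W E) (s : W' → Bool) : normSq (attachReg ψ s) = normSq ψ := by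
  simp only [normSq]
  rw [sum_sumElim, Finset.sum_eq_single s]
  · simp [attachReg]
  · intro b _ hb
    simp [attachReg, hb]
  · simp

/-- The outcomes partition the basis strings by their value on the measured register, and everything
before the measurement is an isometry. -/
lemma sum_normSq_playRound {B : Type} [Fintype B] [DecidableEq B]
    (C : Circuit (W ⊕ (W' ⊕ B))) (msg : W' → Bool) (ψ : QState W E) :
    ∑ reply, normSq (playRound C msg reply ψ) = normSq ψ := by
  rw [← normSq_attachReg ψ (Sum.elim msg (fun _ : B => false)), ← Circuit.normSq_run C]
  simp only [normSq, playRound]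
  rw [Finset.sum_comm]
  refine Finset.sum_congr rfl fun z _ => ?_
  rw [Finset.sum_eq_single (fun b => z (Sum.inr (Sum.inr b)))]
  · simp
  · intro b _ hb
    simp [Ne.symm hb]
  · simp

end Inner

end Circuits

/-! ## The equation test -/

section EquationTest

variable {W M E : Type} [DecidableEq W] [Fintype W] [DecidableEq M] [Fintype M]
  [NormedAddCommGroup E] [InnerProductSpace ℂ E]

lemma dotSign_eq {n : ℕ} (x y : Bits n) : dotSign x y = if x.dot y = 0 then 1 else -1 := by
  have : ∀ (s : Finset (Fin n)), (∏ i ∈ s, if x i && y i then (-1 : ℂ) else 1) =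
      if (∑ i ∈ s, if x i && y i then (1 : ZMod 2) else 0) = 0 then 1 else -1 := by
    intro s
    induction s using Finset.induction_on with
    | empty => simp
    | insert i s hi ih =>
      rw [Finset.prod_insert hi, Finset.sum_insert hi, ih]
      generalize (∑ i ∈ s, if x i && y i then (1 : ZMod 2) else 0) = t
      have h10 : (1 : ZMod 2) ≠ 0 := by decide
      have ht : t = 0 ∨ t = 1 := by revert t; decide
      have h11 : (1 : ZMod 2) + 1 = 0 := by decide
      rcases ht with rfl | rfl <;> split_ifs <;> simp_all
  exact this Finset.univ

/-- The gate `Z`. -/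
def zCircuit (i : W) : Circuit W := [.t i, .t i, .t i, .t i]

lemma run_zCircuit (i : W) (ψ : QState W E) (z : W → Bool) :
    (zCircuit i).run ψ z = (if z i then (-1 : ℂ) else 1) • ψ z := by
  simp only [zCircuit, Circuit.run_cons, Circuit.run_nil, Gate.apply]
  split_ifs
  · simp only [smul_smul, ← Complex.exp_add]
    rw [show Complex.I * (Real.pi / 4) + (Complex.I * (Real.pi / 4) + (Complex.I * (Real.pi / 4) +
      Complex.I * (Real.pi / 4))) = Real.pi * Complex.I by ring, Complex.exp_pi_mul_I]
  · simp

/-- Set a fresh message bit to `m`. -/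
def messageCircuit (m : Bool) : Circuit (M ⊕ (Unit ⊕ Unit)) :=
  if m then [.not (Sum.inr (Sum.inl ()))] else []

lemma run_messageCircuit (m : Bool) (φ : QState M E) :
    (messageCircuit m).run (attachReg φ fun _ => false) =
      attachReg φ (Sum.elim (fun _ : Unit => m) (fun _ : Unit => false)) := by
  funext z
  cases m <;> simp [messageCircuit, Circuit.run_cons, Gate.apply, attachReg, funext_iff,
    Unique.forall_iff]

/-- The observable `(-1)^b` of the answer circuit `V` on the message `m`, written as a circuit. -/
def answerObservable (V : Circuit (M ⊕ (Unit ⊕ Unit))) (m : Bool) : Circuit (M ⊕ (Unit ⊕ Unit)) :=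
  (messageCircuit m ++ V) ++ (zCircuit (Sum.inr (Sum.inr ())) ++ Circuit.inv (messageCircuit m ++ V))

lemma length_answerObservable_le (V : Circuit (M ⊕ (Unit ⊕ Unit))) (m : Bool) :
    (answerObservable V m).length ≤ 2 * V.length + 6 := by
  have : (messageCircuit m : Circuit (M ⊕ (Unit ⊕ Unit))).length ≤ 1 := by
    cases m <;> simp [messageCircuit]
  simp [answerObservable, zCircuit]
  omega

/-- Moving the inverse to the left of the inner product leaves a diagonal `Z` between two copies of
the state just before the answer is measured. -/
lemma re_qinner_answerObservable (V : Circuit (M ⊕ (Unit ⊕ Unit))) (m : Bool) (φ : QState M E) :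
    (qinner (attachReg φ fun _ => false)
      ((answerObservable V m).run (attachReg φ fun _ => false))).re =
      normSq (playRound V (fun _ => m) (fun _ => false) φ) -
        normSq (playRound V (fun _ => m) (fun _ => true) φ) := by
  rw [answerObservable, Circuit.run_append, Circuit.run_append, Circuit.qinner_run_inv,
    Circuit.run_append, run_messageCircuit]
  simp only [qinner, normSq, Complex.re_sum]
  rw [← Finset.sum_sub_distrib]
  refine Finset.sum_congr rfl fun z _ => ?_
  rw [run_zCircuit, inner_smul_right]
  simp only [playRound]
  generalize Circuit.run V (attachReg φ (Sum.elim (fun _ : Unit => m) (fun _ : Unit => false))) z = v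
  have hv : (inner ℂ v v).re = ‖v‖ ^ 2 := (norm_sq_eq_re_inner (𝕜 := ℂ) v).symm
  cases h : z (Sum.inr (Sum.inr ())) <;> simp [funext_iff, h, hv, -inner_self_eq_norm_sq_to_K]

/-- The correlation between the two observables of the answer circuit. -/
def correlation (V : Circuit (M ⊕ (Unit ⊕ Unit))) (φ : QState M E) : ℝ :=
  (qinner ((answerObservable V false).run (attachReg φ fun _ => false))
    ((answerObservable V true).run (attachReg φ fun _ => false))).re

/-- This is the nonnegativity of `‖x + ε y - √2 c u‖²`, expanded and divided by `2√2`. The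
coefficient `√2` makes the resulting constant the optimal Tsirelson one. -/
lemma re_inner_combination_le (u x y : E) (c ε : ℝ) (hc : c ^ 2 = 1) (hε : ε ^ 2 = 1) :
    c * ((inner ℂ u x).re + ε * (inner ℂ u y).re) ≤
      √2 / 4 * (‖x‖ ^ 2 + ‖y‖ ^ 2 + 2 * ε * (inner ℂ x y).re + 2 * ‖u‖ ^ 2) := by
  have h2 : √2 ^ 2 = 2 := Real.sq_sqrt (by norm_num)
  have h0 : 0 < √2 := by positivity
  have key : ‖x + (ε : ℂ) • y - ((√2 * c : ℝ) : ℂ) • u‖ ^ 2 =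
      ‖x‖ ^ 2 + ‖y‖ ^ 2 + 2 * ε * (inner ℂ x y).re + 2 * ‖u‖ ^ 2 -
        2 * √2 * (c * ((inner ℂ u x).re + ε * (inner ℂ u y).re)) := by
    rw [norm_sub_sq (𝕜 := ℂ), norm_add_sq (𝕜 := ℂ)]
    have e1 : (inner ℂ x u).re = (inner ℂ u x).re := inner_re_symm (𝕜 := ℂ) x u
    have e2 : (inner ℂ y u).re = (inner ℂ u y).re := inner_re_symm (𝕜 := ℂ) y u
    simp only [inner_add_left, inner_smul_left, inner_smul_right, norm_smul, Complex.conj_ofReal,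
      RCLike.re_to_complex, Complex.add_re, Complex.re_ofReal_mul, Complex.norm_real,
      Real.norm_eq_abs, mul_pow, sq_abs, hc, hε, h2, e1, e2]
    ring
  have := sq_nonneg ‖x + (ε : ℂ) • y - ((√2 * c : ℝ) : ℂ) • u‖
  rw [key] at this
  have h3 := mul_nonneg h0.le this
  rw [mul_sub, ← mul_assoc, show √2 * (2 * √2) = 4 by nlinarith] at h3
  linarith

/-- The pointwise inequality is summed over the basis with `u` the state and `x`, `y` its images
under the two observables; all three have the same norm because circuits are unitary. -/
lemma answer_bias_le (V : Circuit (M ⊕ (Unit ⊕ Unit))) (φ : QState M E) (c ε : ℝ)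
    (hc : c ^ 2 = 1) (hε : ε ^ 2 = 1) :
    c * ((normSq (playRound V (fun _ => false) (fun _ => false) φ) -
        normSq (playRound V (fun _ => false) (fun _ => true) φ)) +
      ε * (normSq (playRound V (fun _ => true) (fun _ => false) φ) -
        normSq (playRound V (fun _ => true) (fun _ => true) φ))) ≤
      √2 * (normSq φ + ε * correlation V φ / 2) := by
  rw [← re_qinner_answerObservable, ← re_qinner_answerObservable]
  have ha := Circuit.normSq_run (answerObservable V false) (attachReg φ fun _ => false)
  have hb := Circuit.normSq_run (answerObservable V true) (attachReg φ fun _ => false)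
  have hv := normSq_attachReg φ (fun _ : Unit ⊕ Unit => false)
  rw [hv] at ha hb
  rw [correlation]
  generalize (answerObservable V false).run (attachReg φ fun _ => false) = a at *
  generalize (answerObservable V true).run (attachReg φ fun _ => false) = b at *
  generalize (attachReg φ fun _ : Unit ⊕ Unit => false) = v at *
  have := Finset.sum_le_sum fun z (_ : z ∈ Finset.univ) =>
    re_inner_combination_le (v z) (a z) (b z) c ε hc hε
  simp only [← Finset.mul_sum, Finset.sum_add_distrib, ← Complex.re_sum] at this
  simp only [normSq] at ha hb hv
  rw [ha, hb, hv] at this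
  simp only [qinner, normSq]
  linarith

/-- The acceptance probability in the equation test, for a given claw and given `r`, `d`. -/
lemma equation_score_le {n : ℕ} (p : Bits n × Bits n) (r d : Bits n)
    (V : Circuit (M ⊕ (Unit ⊕ Unit))) (φ : QState M E) :
    (open Classical in 𝔼 m : Bool, ∑ b : Bool, if equationAccepts (some p) r d m b then
      normSq (playRound V (fun _ : Unit => m) (fun _ : Unit => b) φ) else 0) ≤
    (1 / 2 + √2 / 4) * normSq φ +
      √2 / 8 * ((dotSign r (p.1.xor p.2)).re * correlation V φ) := by
  have hsum : ∀ m : Bool, normSq (playRound V (fun _ : Unit => m) (fun _ : Unit => true) φ) +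
      normSq (playRound V (fun _ : Unit => m) (fun _ : Unit => false) φ) = normSq φ := by
    intro m
    rw [← sum_normSq_playRound V (fun _ : Unit => m) φ,
      ← Equiv.sum_comp (Equiv.funUnique Unit Bool).symm, Fintype.sum_bool]
    rfl
  have h0 := hsum false
  have h1 := hsum true
  -- Here `c` is the correct answer to `m = 0`, and `ε` records whether the answer changes with `m`.
  -- The reply `d` affects only `c`, so it drops out of the bound.
  have hcε : ∃ c ε : ℝ, (c = 1 ∨ c = -1) ∧ ε ^ 2 = 1 ∧ (dotSign r (p.1.xor p.2)).re = ε ∧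
      (correctAnswer p.1 p.2 r d false : ℝ) = c ∧ (correctAnswer p.1 p.2 r d true : ℝ) = c * ε := by
    rw [dotSign_eq]
    simp only [correctAnswer, Bool.false_eq_true, if_true, if_false]
    split_ifs
    · exact ⟨1, 1, by norm_num⟩
    · exact ⟨-1, 1, by norm_num⟩
    · exact ⟨1, -1, by norm_num⟩
    · exact ⟨-1, -1, by norm_num⟩
  obtain ⟨c, ε, hc, hε, he, hf, ht⟩ := hcε
  have hc2 : c ^ 2 = 1 := by rcases hc with rfl | rfl <;> norm_num
  have hb := answer_bias_le V φ c ε hc2 hε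
  -- For a binary outcome, the weight of the answer `c'` is half of the total weight plus half of
  -- `c'` times the bias.
  have hterm : ∀ (m : Bool) (c' : ℝ), (correctAnswer p.1 p.2 r d m : ℝ) = c' → (c' = 1 ∨ c' = -1) →
      (open Classical in ∑ b : Bool, if equationAccepts (some p) r d m b then
        normSq (playRound V (fun _ : Unit => m) (fun _ : Unit => b) φ) else 0) =
      (normSq φ + c' * (normSq (playRound V (fun _ => m) (fun _ => false) φ) -
        normSq (playRound V (fun _ => m) (fun _ => true) φ))) / 2 := by
    intro m c' hm hc'
    rw [← hsum m, Fintype.sum_bool]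
    simp only [equationAccepts]
    rcases hc' with rfl | rfl
    · have : correctAnswer p.1 p.2 r d m = 1 := by exact_mod_cast hm
      simp [this]
      ring
    · have : correctAnswer p.1 p.2 r d m = -1 := by exact_mod_cast hm
      simp [this]
  have hε' : ε = 1 ∨ ε = -1 := sq_eq_one_iff.1 hε
  rw [Fintype.expect_eq_sum_div_card, Fintype.sum_bool, hterm true _ ht, hterm false _ hf hc, he]
  · simp only [Fintype.card_bool]
    push_cast
    linarith
  · rcases hc with rfl | rfl <;> rcases hε' with rfl | rfl <;> norm_num

end EquationTest

/-! ## Extracting a claw from the correlations of the equation test -/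

section Attack

variable {W E : Type} [DecidableEq W] [Fintype W] [NormedAddCommGroup E] [InnerProductSpace ℂ E]
  {m n : ℕ}

lemma extend_eq_of {A B C : Type} {f : A → B} (hf : Function.Injective f) {u : A → C}
    {z t : B → C} (h1 : ∀ i, t (f i) = u i) (h2 : ∀ j, (∀ i, f i ≠ j) → t j = z j) :
    Function.extend f u z = t := by
  funext j
  by_cases hj : ∃ i, f i = j
  · obtain ⟨i, rfl⟩ := hj
    rw [hf.extend_apply, h1]
  · rw [Function.extend_apply' _ _ _ hj, h2 j (fun i hi => hj ⟨i, hi⟩)]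

/-! ### Register layout of the claw finder -/

/-- The wires of the claw finder: the memory of the prover with the registers of the equation test,
a copy of `y`, a copy of `d`, and the two output registers. -/
abbrev AttackWires (W : Type) (m n : ℕ) : Type :=
  ((W ⊕ (Fin n ⊕ Fin n)) ⊕ (Unit ⊕ Unit)) ⊕ (Fin m ⊕ (Fin n ⊕ (Fin n ⊕ Fin n)))

namespace AttackWires

/-- The register holding the challenge `r`. -/
def rReg (i : Fin n) : AttackWires W m n := .inl (.inl (.inr (.inl i)))

/-- The register holding the reply `d`. -/
def dReg (i : Fin n) : AttackWires W m n := .inl (.inl (.inr (.inr i)))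

/-- The register holding the copy of `y`. -/
def yReg (i : Fin m) : AttackWires W m n := .inr (.inl i)

/-- The register holding the copy of `d`. -/
def copyReg (i : Fin n) : AttackWires W m n := .inr (.inr (.inl i))

/-- The output register for the first element of the claw. -/
def fstReg (i : Fin n) : AttackWires W m n := .inr (.inr (.inr (.inl i)))

/-- The output register for the second element of the claw. -/
def sndReg (i : Fin n) : AttackWires W m n := .inr (.inr (.inr (.inr i)))

/-- The wires of the equation circuit. -/
def equationEmb : W ⊕ (Fin n ⊕ Fin n) ↪ AttackWires W m n :=
  ⟨fun w => .inl (.inl w), fun _ _ h => Sum.inl_injective (Sum.inl_injective h)⟩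

/-- The wires of the answer circuit. -/
def answerEmb : (W ⊕ (Fin n ⊕ Fin n)) ⊕ (Unit ⊕ Unit) ↪ AttackWires W m n :=
  ⟨Sum.inl, Sum.inl_injective⟩

/-- The wires of the preimage circuit. -/
def preimageEmb : W ⊕ (Empty ⊕ Fin n) ↪ AttackWires W m n :=
  ⟨Sum.elim (fun w => .inl (.inl (.inl w))) (Sum.elim (fun e => e.elim) fstReg), by
    rintro (a | a | a) (b | b | b) h <;>
      first | exact a.elim | exact b.elim | simp_all [fstReg]⟩

/-- The second output register. -/
def sndEmb : Fin n ↪ AttackWires W m n := ⟨sndReg, fun _ _ h => by simpa [sndReg] using h⟩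

/-- Assemble an assignment of the wires. -/
def conf (w : W → Bool) (r d : Bits n) (b : Unit ⊕ Unit → Bool) (y : Bits m) (c o x : Bits n) :
    AttackWires W m n → Bool :=
  Sum.elim (Sum.elim (Sum.elim w (Sum.elim r d)) b) (Sum.elim y (Sum.elim c (Sum.elim o x)))

lemma exists_conf (z : AttackWires W m n → Bool) :
    ∃ w r d b y c o x, z = conf w r d b y c o x := by
  refine ⟨fun i => z (.inl (.inl (.inl i))), fun i => z (rReg i), fun i => z (dReg i),
    fun i => z (.inl (.inr i)), fun i => z (yReg i), fun i => z (copyReg i), fun i => z (fstReg i),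
    fun i => z (sndReg i), ?_⟩
  funext j
  rcases j with ((j | j | j) | j) | j | j | j | j <;> rfl

lemma sum_conf {M : Type*} [AddCommMonoid M] (f : (AttackWires W m n → Bool) → M) :
    ∑ z, f z = ∑ x, ∑ o, ∑ c, ∑ y, ∑ b, ∑ d, ∑ r, ∑ w, f (conf w r d b y c o x) := by
  simp only [sum_sumElim]
  rfl

end AttackWires

open AttackWires

/-- The states in which all auxiliary registers but the copy of `y` and the second output register
are zero. -/
def attackState (Ψ : Bits m → Bits n → QState W E) : QState (AttackWires W m n) E := fun z =>
  if (fun i => z (rReg i)) = (fun _ => false) ∧ (fun i => z (dReg i)) = (fun _ => false) ∧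
      (fun i => z (.inl (.inr i))) = (fun _ => false) ∧
      (fun i => z (copyReg i)) = (fun _ => false) ∧ (fun i => z (fstReg i)) = (fun _ => false)
  then Ψ (fun i => z (yReg i)) (fun i => z (sndReg i)) (fun i => z (.inl (.inl (.inl i)))) else 0

lemma attackState_conf (Ψ : Bits m → Bits n → QState W E) (w : W → Bool) (r d : Bits n)
    (b : Unit ⊕ Unit → Bool) (y : Bits m) (c o x : Bits n) :
    attackState Ψ (conf w r d b y c o x) =
      if r = (fun _ => false) ∧ d = (fun _ => false) ∧ b = (fun _ => false) ∧
        c = (fun _ => false) ∧ o = (fun _ => false) then Ψ y x w else 0 := rfl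

lemma normSq_attackState (Ψ : Bits m → Bits n → QState W E) :
    normSq (attackState Ψ) = ∑ x, ∑ y, normSq (Ψ y x) := by
  rw [normSq, sum_conf]
  simp only [attackState_conf]
  refine Finset.sum_congr rfl fun x _ => ?_
  rw [Finset.sum_eq_single (fun _ => false)]
  rotate_left
  · intro o _ ho; simp [ho]
  · simp
  rw [Finset.sum_eq_single (fun _ => false)]
  rotate_left
  · intro o _ ho; simp [ho]
  · simp
  refine Finset.sum_congr rfl fun y _ => ?_
  rw [Finset.sum_eq_single (fun _ => false)]
  rotate_left
  · intro o _ ho; simp [ho]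
  · simp
  rw [Finset.sum_eq_single (fun _ => false)]
  rotate_left
  · intro o _ ho; simp [ho]
  · simp
  rw [Finset.sum_eq_single (fun _ => false)]
  rotate_left
  · intro o _ ho; simp [ho]
  · simp
  simp [normSq]

/-- Hadamard gates on the second output register. -/
def attackHad : Circuit (AttackWires W m n) := (hadCircuit n).rename sndEmb

/-- Used twice: with the zero string for the uniform superposition of challenges that the finder
starts from, and with the exclusive or of the claw for the target state, where it produces the
Fourier character `(-1)^{r·s}`. -/
lemma run_attackHad (ψ : Bits m → QState W E) (s : Bits m → Bits n) :
    Circuit.run attackHad (attackState fun y x => if x = s y then ψ y else 0) =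
      attackState fun y x => ((((√2 : ℝ) : ℂ)⁻¹) ^ n * dotSign x (s y)) • ψ y := by
  funext z
  obtain ⟨w, r, d, b, y, c, o, x, rfl⟩ := exists_conf z
  rw [attackHad, Circuit.run_rename]
  have hext : ∀ x', Function.extend sndEmb x' (conf w r d b y c o x) = conf w r d b y c o x' := by
    intro x'
    refine extend_eq_of sndEmb.injective (fun i => rfl) ?_
    rintro (((j | j | j) | j) | j | j | j | j) hj <;> try rfl
    exact absurd rfl (hj j)
  simp only [hext, attackState_conf]
  have hx : conf w r d b y c o x ∘ sndEmb = x := rfl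
  rw [hx]
  by_cases h : r = (fun _ => false) ∧ d = (fun _ => false) ∧ b = (fun _ => false) ∧
        c = (fun _ => false) ∧ o = (fun _ => false)
  · simp only [if_pos h]
    rw [Pi.smul_apply, ← run_hadCircuit (s y) (ψ y w) x]
    congr 1
    funext x'
    split_ifs <;> rfl
  · simp only [if_neg h]
    exact congrFun (Circuit.run_zero _) _

/-- The equation test up to the reply `d`, on a coherent challenge. -/
def attackEquation (U : Circuit (W ⊕ (Fin n ⊕ Fin n))) : Circuit (AttackWires W m n) :=
  copyCircuit sndReg rReg (fun _ _ h => by simp [sndReg, rReg] at h) ++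
    (U.rename equationEmb ++ copyCircuit dReg copyReg (fun _ _ h => by simp [copyReg, dReg] at h))

lemma Bits.xor_eq_false_iff (r x : Bits n) :
    ((fun i => r i ^^ x i) = fun _ => false) ↔ r = x := by
  simp [funext_iff]

/-- The challenge stays in the second output register and `d` in its copy. These records split the
coherent run into orthogonal slices, each equal to the state of the real protocol for one pair `(r,
d)`. -/
lemma run_attackEquation (U : Circuit (W ⊕ (Fin n ⊕ Fin n))) (Ψ : Bits m → Bits n → QState W E)
    (w : W → Bool) (r d : Bits n) (b : Unit ⊕ Unit → Bool) (y : Bits m) (c o x : Bits n) :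
    (attackEquation U).run (attackState Ψ) (conf w r d b y c o x) =
      if b = (fun _ => false) ∧ o = (fun _ => false) then
        playRound U x c (Ψ y x) (Sum.elim w (Sum.elim r d)) else 0 := by
  have h1 : ∀ w r d b y c o x, Circuit.run (copyCircuit sndReg rReg
      (fun _ _ h => by simp [sndReg, rReg] at h)) (attackState Ψ) (conf w r d b y c o x) =
      if r = x ∧ d = (fun _ => false) ∧ b = (fun _ => false) ∧
        c = (fun _ => false) ∧ o = (fun _ => false) then Ψ y x w else 0 := by
    intro w r d b y c o x
    have hinj : Function.Injective (rReg : Fin n → AttackWires W m n) :=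
      fun _ _ h => by simpa [rReg] using h
    rw [run_copyCircuit _ _ hinj]
    have hext : Function.extend rReg (fun i => conf w r d b y c o x (rReg i) ^^
        conf w r d b y c o x (sndReg i)) (conf w r d b y c o x) =
        conf w (fun i => r i ^^ x i) d b y c o x := by
      refine extend_eq_of hinj (fun i => rfl) ?_
      rintro (((j | j | j) | j) | j | j | j | j) hj <;> try rfl
      exact absurd rfl (hj j)
    rw [hext, attackState_conf]
    simp only [Bits.xor_eq_false_iff]
  have h2 : ∀ w r d b y c o x, (U.rename equationEmb).run (Circuit.run (copyCircuit sndReg rReg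
      (fun _ _ h => by simp [sndReg, rReg] at h)) (attackState Ψ)) (conf w r d b y c o x) =
      if b = (fun _ => false) ∧ c = (fun _ => false) ∧ o = (fun _ => false) then
        U.run (attachReg (Ψ y x) (Sum.elim x (fun _ => false))) (Sum.elim w (Sum.elim r d))
      else 0 := by
    intro w r d b y c o x
    rw [Circuit.run_rename]
    have hext : ∀ u, Function.extend equationEmb u (conf w r d b y c o x) =
        conf (fun i => u (.inl i)) (fun i => u (.inr (.inl i))) (fun i => u (.inr (.inr i)))
          b y c o x := by
      intro u
      refine extend_eq_of equationEmb.injective (by rintro (i | i | i) <;> rfl) ?_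
      rintro (((j | j | j) | j) | j | j | j | j) hj <;> try rfl
      · exact absurd rfl (hj (.inl j))
      · exact absurd rfl (hj (.inr (.inl j)))
      · exact absurd rfl (hj (.inr (.inr j)))
    have hc : conf w r d b y c o x ∘ equationEmb = Sum.elim w (Sum.elim r d) := by
      funext j; rcases j with j | j | j <;> rfl
    simp only [hext, h1, hc]
    by_cases h : b = (fun _ => false) ∧ c = (fun _ => false) ∧ o = (fun _ => false)
    · rw [if_pos h]
      congr 1
      funext u
      simp only [attachReg, h, and_true]
      refine if_congr ?_ rfl rfl
      constructor
      · rintro ⟨h1, h2⟩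
        funext j
        rcases j with j | j
        · exact congrFun h1 j
        · exact congrFun h2 j
      · intro h
        exact ⟨funext fun i => congrFun h (.inl i), funext fun i => congrFun h (.inr i)⟩
    · rw [if_neg h]
      have : ∀ p q : Prop, ¬ (p ∧ q ∧ b = (fun _ => false) ∧ c = (fun _ => false) ∧
        o = (fun _ => false)) := fun p q hpq => h hpq.2.2
      simp only [this, if_false]
      exact congrFun (Circuit.run_zero _) _
  have hinj : Function.Injective (copyReg : Fin n → AttackWires W m n) :=
    fun _ _ h => by simpa [copyReg] using h
  rw [attackEquation, Circuit.run_append, Circuit.run_append, run_copyCircuit _ _ hinj]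
  have hext : Function.extend copyReg (fun i => conf w r d b y c o x (copyReg i) ^^
      conf w r d b y c o x (dReg i)) (conf w r d b y c o x) =
      conf w r d b y (fun i => c i ^^ d i) o x := by
    refine extend_eq_of hinj (fun i => rfl) ?_
    rintro (((j | j | j) | j) | j | j | j | j) hj <;> try rfl
    exact absurd rfl (hj j)
  rw [hext, h2]
  simp only [Bits.xor_eq_false_iff, playRound, Sum.elim_inr]
  by_cases hb : b = (fun _ => false) <;> by_cases ho : o = (fun _ => false)
  · simp [hb, ho, eq_comm]
    rfl
  all_goals simp [hb, ho]

lemma playRound_smul {A B : Type} [Fintype A] [DecidableEq A] [Fintype B] [DecidableEq B]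
    (C : Circuit (W ⊕ (A ⊕ B))) (msg : A → Bool) (reply : B → Bool) (a : ℂ) (ψ : QState W E) :
    playRound C msg reply (a • ψ) = a • playRound C msg reply ψ := by
  have : attachReg (a • ψ) (Sum.elim msg fun _ => false) =
      a • attachReg ψ (Sum.elim msg fun _ : B => false) := by
    funext z
    simp [attachReg]
  funext z
  simp only [playRound, this, Circuit.run_smul, Pi.smul_apply]
  split_ifs <;> simp

lemma attachReg_smul {A : Type} [Fintype A] [DecidableEq A] (a : ℂ) (ψ : QState W E)
    (s : A → Bool) : attachReg (a • ψ) s = a • attachReg ψ s := by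
  funext z
  simp [attachReg]

/-- The preimage circuit, writing to the first output register. -/
def attackPreimage (Q : Circuit (W ⊕ (Empty ⊕ Fin n))) : Circuit (AttackWires W m n) :=
  Q.rename preimageEmb

/-- The second output register is a spectator, so a string stored there does not disturb the
prover's distribution of preimages. -/
lemma run_attackPreimage (Q : Circuit (W ⊕ (Empty ⊕ Fin n))) (Ψ : Bits m → Bits n → QState W E)
    (w : W → Bool) (r d : Bits n) (b : Unit ⊕ Unit → Bool) (y : Bits m) (c o x : Bits n) :
    (attackPreimage Q).run (attackState Ψ) (conf w r d b y c o x) =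
      if r = (fun _ => false) ∧ d = (fun _ => false) ∧ b = (fun _ => false) ∧ c = (fun _ => false)
      then playRound Q (fun e : Empty => e.elim) o (Ψ y x)
        (Sum.elim w (Sum.elim (fun e : Empty => e.elim) o)) else 0 := by
  rw [attackPreimage, Circuit.run_rename]
  have hext : ∀ u, Function.extend preimageEmb u (conf w r d b y c o x) =
      conf (fun i => u (.inl i)) r d b y c (fun i => u (.inr (.inr i))) x := by
    intro u
    refine extend_eq_of preimageEmb.injective (by rintro (i | i | i) <;> first | rfl | cases i) ?_
    rintro (((j | j | j) | j) | j | j | j | j) hj <;> try rfl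
    · exact absurd rfl (hj (.inl j))
    · exact absurd rfl (hj (.inr (.inr j)))
  have hc : conf w r d b y c o x ∘ preimageEmb =
      Sum.elim w (Sum.elim (fun e : Empty => e.elim) o) := by
    funext j; rcases j with j | j | j <;> first | rfl | cases j
  simp only [hext, attackState_conf, hc, playRound, Sum.elim_inr]
  by_cases h : r = (fun _ => false) ∧ d = (fun _ => false) ∧ b = (fun _ => false) ∧
      c = (fun _ => false)
  · rw [if_pos h, if_pos trivial]
    congr 1
    funext u
    simp only [attachReg, h, true_and]
    refine if_congr ?_ rfl rfl
    constructor
    · intro h1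
      funext j
      rcases j with j | j
      · cases j
      · exact congrFun h1 j
    · intro h
      exact funext fun i => congrFun h (.inr i)
  · rw [if_neg h]
    have : ∀ p : Prop, ¬ (r = (fun _ => false) ∧ d = (fun _ => false) ∧ b = (fun _ => false) ∧
      c = (fun _ => false) ∧ p) := fun p hp => h ⟨hp.1, hp.2.1, hp.2.2.1, hp.2.2.2.1⟩
    simp only [this, if_false]
    exact congrFun (Circuit.run_zero _) _

lemma normSq_playRound_empty (Q : Circuit (W ⊕ (Empty ⊕ Fin n))) (o : Bits n) (ψ : QState W E) :
    normSq (playRound Q (fun e : Empty => e.elim) o ψ) =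
      ∑ w, ‖playRound Q (fun e : Empty => e.elim) o ψ
        (Sum.elim w (Sum.elim (fun e : Empty => e.elim) o))‖ ^ 2 := by
  rw [normSq, sum_sumElim, sum_sumElim, Finset.sum_eq_single o]
  · rw [Fintype.sum_unique]
    refine Finset.sum_congr rfl fun w _ => ?_
    congr!
  · intro o' _ ho'
    simp [playRound, ho']
  · simp

/-! ### Correlations as amplitudes, and the Cauchy-Schwarz bound -/

/-- The coherent evaluation of the correlation of the two answers, before the preimage is
measured. -/
def attackCorrelation (U : Circuit (W ⊕ (Fin n ⊕ Fin n)))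
    (V : Circuit ((W ⊕ (Fin n ⊕ Fin n)) ⊕ (Unit ⊕ Unit))) : Circuit (AttackWires W m n) :=
  (attackHad ++ attackEquation U) ++
    ((answerObservable V true).rename answerEmb ++
      (Circuit.inv ((answerObservable V false).rename answerEmb) ++
        Circuit.inv (attackHad ++ attackEquation U)))

lemma Circuit.run_rename_answerEmb (C : Circuit ((W ⊕ (Fin n ⊕ Fin n)) ⊕ (Unit ⊕ Unit)))
    (χ : QState (AttackWires W m n) E) (u : (W ⊕ (Fin n ⊕ Fin n)) ⊕ (Unit ⊕ Unit) → Bool)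
    (v : Fin m ⊕ (Fin n ⊕ (Fin n ⊕ Fin n)) → Bool) :
    (C.rename answerEmb).run χ (Sum.elim u v) = C.run (fun u => χ (Sum.elim u v)) u := by
  have hext : ∀ u', Function.extend answerEmb u' (Sum.elim u v) = Sum.elim u' v := by
    intro u'
    refine extend_eq_of answerEmb.injective (fun i => rfl) ?_
    rintro (j | j) hj
    · exact absurd rfl (hj j)
    · rfl
  rw [Circuit.run_rename]
  simp only [hext]
  rfl

/-- The amplitude with which the claw finder maps the initial state to the state in which the second
output register holds `s y`. -/
lemma re_qinner_attackCorrelation (U : Circuit (W ⊕ (Fin n ⊕ Fin n)))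
    (V : Circuit ((W ⊕ (Fin n ⊕ Fin n)) ⊕ (Unit ⊕ Unit))) (ψ : Bits m → QState W E)
    (s : Bits m → Bits n) (g : Bits m → Prop) [DecidablePred g] :
    (qinner (attackState fun y x => if x = s y then (if g y then ψ y else 0) else 0)
      ((attackCorrelation U V).run (attackState fun y x => if x = (fun _ => false) then ψ y else 0))).re =
      ∑ y, if g y then 𝔼 r : Bits n, ∑ d, (dotSign r (s y)).re * correlation V (playRound U r d (ψ y))
        else 0 := by
  -- Fixing all registers that the answer observables do not touch leaves a single protocol state
  -- with fresh zero qubits.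
  have hslice : ∀ (Ψ : Bits m → Bits n → QState W E) (y : Bits m) (c o x : Bits n),
      (fun u => (attackEquation U).run (attackState Ψ)
        (Sum.elim u (Sum.elim y (Sum.elim c (Sum.elim o x))))) =
      if o = (fun _ => false) then attachReg (playRound U x c (Ψ y x)) (fun _ => false) else 0 := by
    intro Ψ y c o x
    funext u
    have : (Sum.elim u (Sum.elim y (Sum.elim c (Sum.elim o x))) : AttackWires W m n → Bool) =
        conf (fun i => u (.inl (.inl i))) (fun i => u (.inl (.inr (.inl i))))
          (fun i => u (.inl (.inr (.inr i)))) (fun i => u (.inr i)) y c o x := by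
      funext j; rcases j with ((j | j | j) | j) | j | j | j | j <;> rfl
    rw [this, run_attackEquation]
    have hu : (Sum.elim (fun i => u (.inl (.inl i))) (Sum.elim (fun i => u (.inl (.inr (.inl i))))
          (fun i => u (.inl (.inr (.inr i)))))) = fun w => u (.inl w) := by
      funext j; rcases j with j | j | j <;> rfl
    rw [hu]
    by_cases ho : o = (fun _ => false) <;> simp [ho, attachReg]
  -- Both trailing inverses move to the left entry. The target state is thereby also sent through
  -- the Hadamard gates and the equation test, and then through the observable for `m = 0`.
  rw [attackCorrelation, Circuit.run_append, Circuit.run_append, Circuit.run_append,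
    Circuit.qinner_run_inv, Circuit.qinner_run_inv, Circuit.run_append, Circuit.run_append,
    run_attackHad, run_attackHad (s := fun _ _ => false), qinner, sum_sumElim]
  simp only [sum_sumElim (W := Fin m), sum_sumElim (W := Fin n) (W' := Fin n ⊕ Fin n),
    sum_sumElim (W := Fin n) (W' := Fin n), Circuit.run_rename_answerEmb, hslice]
  have hzero : ∀ x : Bits n, dotSign x (fun _ => false) = 1 := by intro x; simp [dotSign]
  have hreal : ∀ x y : Bits n, dotSign x y = ((dotSign x y).re : ℂ) := by
    intro x y; rw [dotSign_eq]; split_ifs <;> simp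
  have hterm : ∀ (x o c : Bits n) (y : Bits m),
      (∑ u, inner ℂ ((answerObservable V false).run (if o = (fun _ => false) then
        attachReg (playRound U x c ((((√2 : ℝ) : ℂ)⁻¹ ^ n * dotSign x (s y)) •
          if g y then ψ y else 0)) (fun _ => false) else 0) u)
        ((answerObservable V true).run (if o = (fun _ => false) then
        attachReg (playRound U x c ((((√2 : ℝ) : ℂ)⁻¹ ^ n * dotSign x (fun _ => false)) •
          ψ y)) (fun _ => false) else 0) u)).re = if o = (fun _ => false) then
          (if g y then (2⁻¹ : ℝ) ^ n * ((dotSign x (s y)).re * correlation V (playRound U x c (ψ y)))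
          else 0) else 0 := by
    intro x o c y
    by_cases ho : o = (fun _ => false)
    · by_cases hg : g y
      · simp only [if_pos ho, if_pos hg, hzero, mul_one]
        -- The two normalisations `2^{-n/2}` combine to `2^{-n}`, the weight of one challenge in the
        -- uniform average; the sign is real, so conjugation does not matter.
        have hpow : (starRingEnd ℂ) ((((√2 : ℝ) : ℂ)⁻¹) ^ n * dotSign x (s y)) *
            (((√2 : ℝ) : ℂ)⁻¹) ^ n = (((2⁻¹ : ℝ) ^ n * (dotSign x (s y)).re : ℝ) : ℂ) := by
          rw [hreal x (s y), map_mul, map_pow, map_inv₀, Complex.conj_ofReal, Complex.conj_ofReal,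
            mul_right_comm, ← mul_pow, inv_sqrt_two_mul_self]
          simp
        simp only [playRound_smul, attachReg_smul, Circuit.run_smul, Pi.smul_apply,
          inner_smul_left, inner_smul_right]
        rw [correlation, qinner, ← mul_assoc, ← Complex.re_ofReal_mul, Finset.mul_sum, ← hpow]
        congr 1
        refine Finset.sum_congr rfl fun u _ => ?_
        ring
      · have h0 : playRound U x c (0 : QState W E) = 0 := by
          simpa using playRound_smul U x c (0 : ℂ) (0 : QState W E)
        have h1 : attachReg (0 : QState (W ⊕ (Fin n ⊕ Fin n)) E)
            (fun _ : Unit ⊕ Unit => false) = 0 := by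
          simpa using attachReg_smul (0 : ℂ) (0 : QState (W ⊕ (Fin n ⊕ Fin n)) E)
            (fun _ : Unit ⊕ Unit => false)
        simp [ho, hg, h0, h1, Circuit.run_zero]
    · simp [ho, Circuit.run_zero]
  simp only [Complex.re_sum] at hterm ⊢
  simp only [hterm]
  simp only [Fintype.expect_eq_sum_div_card]
  have : ∀ x : Bits n, (∑ o : Bits n, ∑ c : Bits n, ∑ y : Bits m, if o = (fun _ => false) then
          (if g y then (2⁻¹ : ℝ) ^ n * ((dotSign x (s y)).re * correlation V (playRound U x c (ψ y)))
          else 0) else 0) = ∑ c : Bits n, ∑ y : Bits m, if g y then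
          (2⁻¹ : ℝ) ^ n * ((dotSign x (s y)).re * correlation V (playRound U x c (ψ y))) else 0 := by
    intro x
    rw [Finset.sum_eq_single (fun _ => false)]
    · simp
    · intro o _ ho; simp [ho]
    · simp
  simp only [this]
  have hcard : ((Fintype.card (Bits n) : ℕ) : ℝ)⁻¹ = (2⁻¹ : ℝ) ^ n := by simp
  simp only [div_eq_inv_mul, hcard]
  have : ∀ x : Bits n, (∑ c : Bits n, ∑ y : Bits m, if g y then
          (2⁻¹ : ℝ) ^ n * ((dotSign x (s y)).re * correlation V (playRound U x c (ψ y))) else 0) =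
      ∑ y : Bits m, ∑ c : Bits n, if g y then
          (2⁻¹ : ℝ) ^ n * ((dotSign x (s y)).re * correlation V (playRound U x c (ψ y))) else 0 :=
    fun x => Finset.sum_comm
  simp only [this]
  rw [Finset.sum_comm]
  refine Finset.sum_congr rfl fun y _ => ?_
  split_ifs
  · simp only [Finset.mul_sum]
  · simp

/-- The claw finder on a prover that has committed to `y`. -/
def attackCircuit (U : Circuit (W ⊕ (Fin n ⊕ Fin n)))
    (V : Circuit ((W ⊕ (Fin n ⊕ Fin n)) ⊕ (Unit ⊕ Unit))) (Q : Circuit (W ⊕ (Empty ⊕ Fin n))) :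
    Circuit (AttackWires W m n) :=
  attackCorrelation U V ++ attackPreimage Q

/-- The correlation of the answers, with sign `(-1)^{r · s y}`, is bounded by the amplitude with which
the claw finder outputs an accepted preimage together with `s y`, and by the amplitude with which the
prover fails to give an accepted preimage. -/
lemma sum_correlation_le (U : Circuit (W ⊕ (Fin n ⊕ Fin n)))
    (V : Circuit ((W ⊕ (Fin n ⊕ Fin n)) ⊕ (Unit ⊕ Unit))) (Q : Circuit (W ⊕ (Empty ⊕ Fin n)))
    (ψ : Bits m → QState W E) (hψ : ∑ y, normSq (ψ y) = 1)
    (s : Bits m → Bits n) (g : Bits m → Prop) [DecidablePred g] (acc : Bits m → Bits n → Prop)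
    [∀ y, DecidablePred (acc y)] :
    (∑ y, if g y then 𝔼 r : Bits n, ∑ d, (dotSign r (s y)).re * correlation V (playRound U r d (ψ y))
        else 0) ≤
      √(∑ z, if g (fun i => z (yReg i)) ∧ acc (fun i => z (yReg i)) (fun i => z (fstReg i)) ∧
          (fun i => z (sndReg i)) = s (fun i => z (yReg i)) then
          ‖(attackCircuit U V Q).run (attackState fun y x => if x = (fun _ => false) then ψ y else 0) z‖ ^ 2
        else 0) +
      √(∑ y, if g y then ∑ o, if acc y o then 0 else
        normSq (playRound Q (fun e : Empty => e.elim) o (ψ y)) else 0) := by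
  rw [← re_qinner_attackCorrelation, ← Circuit.qinner_run (attackPreimage Q), ← Circuit.run_append]
  change Complex.re (qinner _ ((attackCircuit U V Q).run _)) ≤ _
  have hσ : normSq ((attackCircuit U V Q).run
      (attackState fun y x => if x = (fun _ => false) then ψ y else 0)) = 1 := by
    rw [Circuit.normSq_run, normSq_attackState, ← hψ, Finset.sum_eq_single (fun _ => false)]
    · simp
    · intro x _ hx; simp [hx, normSq]
    · simp
  -- Only an inequality: the target state keeps just the commitments `y` satisfying `g`.
  have hτ : normSq ((attackPreimage Q).run (attackState fun y x => if x = s y then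
      (if g y then ψ y else 0) else 0)) ≤ 1 := by
    rw [Circuit.normSq_run, normSq_attackState, ← hψ, Finset.sum_comm]
    refine Finset.sum_le_sum fun y _ => ?_
    rw [Finset.sum_eq_single (s y)]
    · rw [if_pos rfl]
      split_ifs
      · exact le_rfl
      · simpa [normSq] using normSq_nonneg (ψ y)
    · intro x _ hx; simp [hx, normSq]
    · simp
  have hconf := run_attackPreimage Q (fun y x => if x = s y then (if g y then ψ y else 0) else 0)
  generalize (attackCircuit U V Q).run (attackState fun y x =>
    if x = (fun _ => false) then ψ y else 0) = Ω at *
  generalize (attackPreimage Q).run (attackState fun y x => if x = s y then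
    (if g y then ψ y else 0) else 0) = τ at *
  let A : (AttackWires W m n → Bool) → Prop := fun z => g (fun i => z (yReg i)) ∧
    acc (fun i => z (yReg i)) (fun i => z (fstReg i)) ∧
      (fun i => z (sndReg i)) = s (fun i => z (yReg i))
  have h0 : ∀ ψ : QState W E, ψ = 0 → ∀ o, playRound Q (fun e : Empty => e.elim) o ψ = 0 := by
    rintro _ rfl o
    simpa using playRound_smul Q (fun e : Empty => e.elim) o (0 : ℂ) (0 : QState W E)
  -- On the event `A` the norm of `τ` is bounded by one and the weight of `Ω` is kept; off `A` the
  -- roles are exchanged.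
  rw [qinner, Complex.re_sum, ← Finset.sum_filter_add_sum_filter_not Finset.univ A,
    ← Finset.sum_filter]
  refine add_le_add ?_ ?_
  · refine (sum_re_inner_le _ _ _).trans ?_
    refine mul_le_of_le_one_left (Real.sqrt_nonneg _) (Real.sqrt_le_one.2 (le_trans ?_ hτ))
    exact Finset.sum_le_sum_of_subset_of_nonneg (Finset.subset_univ _) fun _ _ _ => by positivity
  · refine (sum_re_inner_le _ _ _).trans ?_
    refine (mul_le_of_le_one_right (Real.sqrt_nonneg _) (Real.sqrt_le_one.2 ?_)).trans ?_
    · rw [← hσ]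
      exact Finset.sum_le_sum_of_subset_of_nonneg (Finset.subset_univ _) fun _ _ _ => by positivity
    refine Real.sqrt_le_sqrt (le_of_eq ?_)
    rw [Finset.sum_filter, sum_conf]
    have hA : ∀ w r d b y c o x, A (conf w r d b y c o x) ↔ g y ∧ acc y o ∧ x = s y :=
      fun _ _ _ _ _ _ _ _ => Iff.rfl
    simp only [hA, hconf]
    -- In `τ` the second output register always equals `s y`, so off `A` only rejected preimages
    -- remain.
    have hcollapse : ∀ x o : Bits n, (∑ c : Bits n, ∑ y, ∑ b : Unit ⊕ Unit → Bool, ∑ d : Bits n,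
        ∑ r : Bits n, ∑ w, if ¬(g y ∧ acc y o ∧ x = s y) then
          ‖if r = (fun _ => false) ∧ d = (fun _ => false) ∧ b = (fun _ => false) ∧
            c = (fun _ => false) then playRound Q (fun e : Empty => e.elim) o
            (if x = s y then (if g y then ψ y else 0) else 0)
            (Sum.elim w (Sum.elim (fun e : Empty => e.elim) o)) else 0‖ ^ 2 else 0) =
        ∑ y, if x = s y then (if g y then (if acc y o then 0 else
          normSq (playRound Q (fun e : Empty => e.elim) o (ψ y))) else 0) else 0 := by
      intro x o
      rw [Finset.sum_eq_single (fun _ => false)]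
      rotate_left
      · intro c _ hc; simp [hc]
      · simp
      refine Finset.sum_congr rfl fun y _ => ?_
      rw [Finset.sum_eq_single (fun _ => false)]
      rotate_left
      · intro c _ hc; simp [hc]
      · simp
      rw [Finset.sum_eq_single (fun _ => false)]
      rotate_left
      · intro c _ hc; simp [hc]
      · simp
      rw [Finset.sum_eq_single (fun _ => false)]
      rotate_left
      · intro c _ hc; simp [hc]
      · simp
      rw [normSq_playRound_empty]
      by_cases hx : x = s y <;> by_cases hg : g y <;> by_cases ha : acc y o <;>
        simp [hx, hg, ha, h0 0 rfl]
    simp only [hcollapse]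
    rw [Finset.sum_congr rfl fun x _ => Finset.sum_comm, Finset.sum_comm]
    refine Finset.sum_congr rfl fun y _ => ?_
    rw [Finset.sum_eq_single (s y)]
    · by_cases hg : g y <;> simp [hg]
    · intro x _ hx; simp [hx]
    · simp

end Attack

/-! ## The claw finder -/

section ClawFinder

variable {M K E : Type} [DecidableEq M] [Fintype M] [DecidableEq K] [Fintype K]
  [NormedAddCommGroup E] [InnerProductSpace ℂ E] {m n : ℕ}

open AttackWires

/-- The wires of the first round of the prover. -/
def memoryEmb {W : Type} : W ↪ AttackWires W m n :=
  ⟨fun w => .inl (.inl (.inl w)), fun _ _ h => by simpa using h⟩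

/-- The register in which the prover holds `y`. -/
def commitReg (i : Fin m) : AttackWires (M ⊕ (K ⊕ Fin m)) m n := .inl (.inl (.inl (.inr (.inr i))))

/-- The first round of the prover, with a copy of `y` in place of its measurement. -/
def attackCommit (C : Circuit (M ⊕ (K ⊕ Fin m))) : Circuit (AttackWires (M ⊕ (K ⊕ Fin m)) m n) :=
  C.rename memoryEmb ++
    copyCircuit commitReg yReg (fun _ _ h => by simp [commitReg, yReg] at h)

/-- The initial state of the claw finder. -/
def attackInit (k : K → Bool) (φ : QState M E) : QState (AttackWires (M ⊕ (K ⊕ Fin m)) m n) E :=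
  attackState fun y x => if x = (fun _ => false) then
    (if y = (fun _ => false) then attachReg φ (Sum.elim k fun _ => false) else 0) else 0

/-- The finder does not measure `y`; it keeps a copy, which the later circuits do not alter, so that
the commitments form orthogonal branches. -/
lemma run_attackCommit (C : Circuit (M ⊕ (K ⊕ Fin m))) (k : K → Bool) (φ : QState M E) :
    (attackCommit C).run (attackInit k φ : QState (AttackWires (M ⊕ (K ⊕ Fin m)) m n) E) =
      attackState fun y x => if x = (fun _ => false) then playRound C k y φ else 0 := by
  funext z
  obtain ⟨w, r, d, b, y, c, o, x, rfl⟩ := exists_conf z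
  have hinj : Function.Injective (yReg : Fin m → AttackWires (M ⊕ (K ⊕ Fin m)) m n) :=
    fun _ _ h => by simpa [yReg] using h
  rw [attackCommit, Circuit.run_append, run_copyCircuit _ _ hinj]
  have hext : Function.extend yReg (fun i => conf w r d b y c o x (yReg i) ^^
      conf w r d b y c o x (commitReg i)) (conf w r d b y c o x) =
      conf w r d b (fun i => y i ^^ w (.inr (.inr i))) c o x := by
    refine extend_eq_of hinj (fun i => rfl) ?_
    rintro (((j | j | j) | j) | j | j | j | j) hj <;> try rfl
    exact absurd rfl (hj j)
  have hext' : ∀ (y : Bits m) u, Function.extend memoryEmb u (conf w r d b y c o x) =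
      conf u r d b y c o x := by
    intro y u
    refine extend_eq_of memoryEmb.injective (fun i => rfl) ?_
    rintro (((j | j | j) | j) | j | j | j | j) hj <;> try rfl
    exact absurd rfl (hj j)
  have hc : ∀ y : Bits m, conf w r d b y c o x ∘ memoryEmb = w := fun y => rfl
  rw [hext, Circuit.run_rename]
  simp only [hext', hc, attackInit, attackState_conf, Bits.xor_eq_false_iff]
  by_cases h : r = (fun _ => false) ∧ d = (fun _ => false) ∧ b = (fun _ => false) ∧
      c = (fun _ => false) ∧ o = (fun _ => false)
  · by_cases hx : x = (fun _ => false)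
    · by_cases hy : y = fun i => w (.inr (.inr i))
      · simp only [if_pos h, if_pos hx, if_pos hy, playRound, if_pos hy.symm]
      · simp only [if_pos h, if_pos hx, if_neg hy, playRound, if_neg (Ne.symm hy)]
        exact congrFun (Circuit.run_zero _) _
    · simp only [if_pos h, if_neg hx]
      exact congrFun (Circuit.run_zero _) _
  · simp only [if_neg h]
    exact congrFun (Circuit.run_zero _) _

/-- The claw finder. -/
def clawCircuit (C : Circuit (M ⊕ (K ⊕ Fin m))) (U : Circuit ((M ⊕ (K ⊕ Fin m)) ⊕ (Fin n ⊕ Fin n)))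
    (V : Circuit (((M ⊕ (K ⊕ Fin m)) ⊕ (Fin n ⊕ Fin n)) ⊕ (Unit ⊕ Unit)))
    (Q : Circuit ((M ⊕ (K ⊕ Fin m)) ⊕ (Empty ⊕ Fin n))) :
    Circuit (AttackWires (M ⊕ (K ⊕ Fin m)) m n) :=
  attackCommit C ++ (attackCircuit U V Q ++
    copyCircuit fstReg sndReg (fun _ _ h => by simp [fstReg, sndReg] at h))

/-- The coherent test is run and undone, giving `2|U|` and `6n`; each of the two observables
contains `V` and its inverse, giving `4|V| + 12`; the final copy adds the seventh `n`. -/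
lemma length_clawCircuit_le (C : Circuit (M ⊕ (K ⊕ Fin m)))
    (U : Circuit ((M ⊕ (K ⊕ Fin m)) ⊕ (Fin n ⊕ Fin n)))
    (V : Circuit (((M ⊕ (K ⊕ Fin m)) ⊕ (Fin n ⊕ Fin n)) ⊕ (Unit ⊕ Unit)))
    (Q : Circuit ((M ⊕ (K ⊕ Fin m)) ⊕ (Empty ⊕ Fin n))) :
    (clawCircuit C U V Q).length ≤
      C.length + m + 7 * n + 2 * U.length + 4 * V.length + Q.length + 12 := by
  have h1 := length_answerObservable_le V true
  have h2 := length_answerObservable_le V false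
  simp [clawCircuit, attackCommit, attackCircuit, attackCorrelation, attackPreimage, attackHad,
    attackEquation]
  omega

/-- The output distribution of the claw finder. -/
lemma run_clawCircuit_sum (C : Circuit (M ⊕ (K ⊕ Fin m)))
    (U : Circuit ((M ⊕ (K ⊕ Fin m)) ⊕ (Fin n ⊕ Fin n)))
    (V : Circuit (((M ⊕ (K ⊕ Fin m)) ⊕ (Fin n ⊕ Fin n)) ⊕ (Unit ⊕ Unit)))
    (Q : Circuit ((M ⊕ (K ⊕ Fin m)) ⊕ (Empty ⊕ Fin n))) (k : K → Bool) (φ : QState M E)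
    (T : Bits n → Bits n → Prop) [∀ x₀ x₁, Decidable (T x₀ x₁)] :
    ∑ z, (if T (fun i => z (fstReg i)) (fun i => z (sndReg i)) then
        ‖(clawCircuit C U V Q).run (attackInit k φ) z‖ ^ 2 else 0) =
      ∑ z, if T (fun i => z (fstReg i)) (fun i => z (sndReg i) ^^ z (fstReg i)) then
        ‖(attackCircuit U V Q).run (attackState fun y x => if x = (fun _ => false) then
          playRound C k y φ else 0) z‖ ^ 2 else 0 := by
  have hinj : Function.Injective (sndReg : Fin n → AttackWires (M ⊕ (K ⊕ Fin m)) m n) :=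
    fun _ _ h => by simpa [sndReg] using h
  rw [clawCircuit, Circuit.run_append, Circuit.run_append, run_attackCommit]
  generalize (attackCircuit U V Q).run (attackState fun y x => if x = (fun _ => false) then
    playRound C k y φ else 0) = Ω
  -- The final copy replaces `(x, s)` by `(x, x ⊕ s)`. It is an involution of the basis strings, so
  -- the sum can be reindexed by it.
  let f : (AttackWires (M ⊕ (K ⊕ Fin m)) m n → Bool) → (AttackWires (M ⊕ (K ⊕ Fin m)) m n → Bool) :=
    fun z => Function.extend sndReg (fun i => z (sndReg i) ^^ z (fstReg i)) z
  have hsnd : ∀ z i, f z (sndReg i) = (z (sndReg i) ^^ z (fstReg i)) := fun z i =>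
    hinj.extend_apply _ _ i
  have hfst : ∀ z i, f z (fstReg i) = z (fstReg i) := fun z i =>
    Function.extend_apply' _ _ _ (by rintro ⟨j, hj⟩; simp [fstReg, sndReg] at hj)
  have hf : Function.Involutive f := by
    intro z
    refine extend_eq_of hinj (fun i => ?_) (fun j hj => ?_)
    · rw [hsnd, hfst]; simp
    · exact (Function.extend_apply' _ _ _ (by rintro ⟨i, hi⟩; exact hj i hi)).symm
  rw [← Equiv.sum_comp hf.toPerm]
  refine Finset.sum_congr rfl fun z _ => ?_
  have hrun : (copyCircuit fstReg sndReg (fun _ _ h => by simp [fstReg, sndReg] at h)).run Ω (f z) =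
      Ω z := by
    rw [run_copyCircuit _ _ hinj]
    exact congrArg Ω (hf z)
  show (if T (fun i => f z (fstReg i)) (fun i => f z (sndReg i)) then _ else _) = _
  simp only [hsnd, hfst]
  exact if_congr Iff.rfl (congrArg (fun v => ‖v‖ ^ 2) hrun) rfl

/-! ### Fitting the claw finder into the adversary model -/

/-- The wires outside of the input and output registers and of the initial state. -/
abbrev AttackWork (B : Type) (m n : ℕ) : Type :=
  B ⊕ (Fin m ⊕ (Fin n ⊕ (Fin n ⊕ ((Unit ⊕ Unit) ⊕ (Fin m ⊕ Fin n)))))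

/-- Arranging the wires into initial state, workspace, input and output. -/
def attackArrange (A B K : Type) (m n : ℕ) :
    AttackWires ((A ⊕ B) ⊕ (K ⊕ Fin m)) m n ≃ (A ⊕ AttackWork B m n) ⊕ (K ⊕ (Fin n ⊕ Fin n)) where
  toFun
    | .inl (.inl (.inl (.inl (.inl a)))) => .inl (.inl a)
    | .inl (.inl (.inl (.inl (.inr b)))) => .inl (.inr (.inl b))
    | .inl (.inl (.inl (.inr (.inl k)))) => .inr (.inl k)
    | .inl (.inl (.inl (.inr (.inr y)))) => .inl (.inr (.inr (.inl y)))
    | .inl (.inl (.inr (.inl r))) => .inl (.inr (.inr (.inr (.inl r))))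
    | .inl (.inl (.inr (.inr d))) => .inl (.inr (.inr (.inr (.inr (.inl d)))))
    | .inl (.inr b) => .inl (.inr (.inr (.inr (.inr (.inr (.inl b))))))
    | .inr (.inl y) => .inl (.inr (.inr (.inr (.inr (.inr (.inr (.inl y)))))))
    | .inr (.inr (.inl c)) => .inl (.inr (.inr (.inr (.inr (.inr (.inr (.inr c)))))))
    | .inr (.inr (.inr (.inl o))) => .inr (.inr (.inl o))
    | .inr (.inr (.inr (.inr x))) => .inr (.inr (.inr x))
  invFun
    | .inl (.inl a) => .inl (.inl (.inl (.inl (.inl a))))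
    | .inl (.inr (.inl b)) => .inl (.inl (.inl (.inl (.inr b))))
    | .inr (.inl k) => .inl (.inl (.inl (.inr (.inl k))))
    | .inl (.inr (.inr (.inl y))) => .inl (.inl (.inl (.inr (.inr y))))
    | .inl (.inr (.inr (.inr (.inl r)))) => .inl (.inl (.inr (.inl r)))
    | .inl (.inr (.inr (.inr (.inr (.inl d))))) => .inl (.inl (.inr (.inr d)))
    | .inl (.inr (.inr (.inr (.inr (.inr (.inl b)))))) => .inl (.inr b)
    | .inl (.inr (.inr (.inr (.inr (.inr (.inr (.inl y))))))) => .inr (.inl y)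
    | .inl (.inr (.inr (.inr (.inr (.inr (.inr (.inr c))))))) => .inr (.inr (.inl c))
    | .inr (.inr (.inl o)) => .inr (.inr (.inr (.inl o)))
    | .inr (.inr (.inr x)) => .inr (.inr (.inr (.inr x)))
  left_inv := by
    rintro (((((a | b) | (k | y)) | r | d) | b) | y | c | o | x) <;> rfl
  right_inv := by
    rintro ((a | b | y | r | d | b | y | c) | k | o | x) <;> rfl

/-- The wires of the claw finder as memory, input and output registers of a machine. -/
def attackEquiv {A B K T : Type} {m n : ℕ} (h : AttackWork B m n ≃ T) :
    AttackWires ((A ⊕ B) ⊕ (K ⊕ Fin m)) m n ≃ (A ⊕ T) ⊕ (K ⊕ (Fin n ⊕ Fin n)) :=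
  (attackArrange A B K m n).trans
    (Equiv.sumCongr (Equiv.sumCongr (Equiv.refl A) h) (Equiv.refl _))

/-- Pure bookkeeping: in both descriptions every register is zero except the initial state and the
key. -/
lemma attachReg_attackEquiv {A B T : Type} [Fintype A] [DecidableEq A] [Fintype B] [DecidableEq B]
    [Fintype T] [DecidableEq T] (h : AttackWork B m n ≃ T) (k : K → Bool) (φ : QState A E)
    (u : AttackWires ((A ⊕ B) ⊕ (K ⊕ Fin m)) m n → Bool) :
    attachReg (attachReg φ fun _ : T => false) (Sum.elim k fun _ => false)
      (u ∘ (attackEquiv h).symm) = attackInit k (attachReg φ fun _ : B => false) u := by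
  obtain ⟨w, r, d, b, y, c, o, x, rfl⟩ := exists_conf u
  obtain ⟨w1, w2, rfl⟩ : ∃ w1 w2, w = Sum.elim w1 w2 :=
    ⟨fun i => w (.inl i), fun i => w (.inr i), by funext j; rcases j with j | j <;> rfl⟩
  have hT : ((fun t => ((conf (Sum.elim w1 w2) r d b y c o x) ∘ (attackEquiv h).symm)
        (Sum.inl (Sum.inr t))) = fun _ => false) ↔
      (fun i => w1 (.inr i)) = (fun _ => false) ∧ (fun i => w2 (.inr i)) = (fun _ => false) ∧
      r = (fun _ => false) ∧ d = (fun _ => false) ∧ b = (fun _ => false) ∧ y = (fun _ => false) ∧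
        c = (fun _ => false) := by
    simp only [funext_iff]
    rw [← h.forall_congr_right]
    have : ∀ a, (conf (Sum.elim w1 w2) r d b y c o x ∘ (attackEquiv h).symm) (Sum.inl (Sum.inr (h a)))
        = conf (Sum.elim w1 w2) r d b y c o x ((attackArrange A B K m n).symm (.inl (.inr a))) := by
      intro a
      simp [attackEquiv]
    simp only [this, Sum.forall]
    simp only [attackArrange, Equiv.coe_fn_symm_mk, conf, Sum.elim_inl, Sum.elim_inr]
  have hK : ((fun a => ((conf (Sum.elim w1 w2) r d b y c o x) ∘ (attackEquiv h).symm)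
        (Sum.inr a)) = Sum.elim k fun _ => false) ↔
      (fun i => w2 (.inl i)) = k ∧ o = (fun _ => false) ∧ x = (fun _ => false) := by
    simp only [funext_iff, Sum.forall]
    rfl
  have hW : ((fun a => w2 a) = Sum.elim k fun _ => false) ↔
      (fun i => w2 (.inl i)) = k ∧ (fun i => w2 (.inr i)) = (fun _ => false) := by
    simp only [funext_iff, Sum.forall]
    rfl
  have hA : (fun a => ((conf (Sum.elim w1 w2) r d b y c o x) ∘ (attackEquiv h).symm)
        (Sum.inl (Sum.inl a))) = fun a => w1 (.inl a) := rfl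
  rw [attackInit, attackState_conf, attachReg, attachReg, hA]
  by_cases hx : x = fun _ => false
  · by_cases hy : y = fun _ => false
    · have key : attachReg (attachReg φ fun _ : B => false) (Sum.elim k fun _ => false)
          (Sum.elim w1 w2) = if ((fun i => w2 (.inl i)) = k ∧ (fun i => w2 (.inr i)) =
            (fun _ => false)) ∧ (fun i => w1 (.inr i)) = (fun _ => false) then
            φ (fun a => w1 (.inl a)) else 0 := by
        show (if (fun a => w2 a) = Sum.elim k fun _ => false then
          (if (fun i => w1 (.inr i)) = (fun _ => false) then φ (fun a => w1 (.inl a)) else 0)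
          else 0) = _
        rw [← ite_and]
        exact if_congr (and_congr hW Iff.rfl) rfl rfl
      rw [if_pos hx, if_pos hy, key, ← ite_and, ← ite_and]
      refine if_congr ((and_congr hK hT).trans ?_) rfl rfl
      constructor
      · rintro ⟨⟨h1, h2, h3⟩, h4, h5, h6, h7, h8, h9, h10⟩
        exact ⟨⟨h6, h7, h8, h10, h2⟩, ⟨h1, h5⟩, h4⟩
      · rintro ⟨⟨h6, h7, h8, h10, h2⟩, ⟨h1, h5⟩, h4⟩
        exact ⟨⟨h1, h2, hx⟩, h4, h5, h6, h7, h8, hy, h10⟩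
    · rw [if_neg (fun hK' => hy (hT.1 hK').2.2.2.2.2.1), if_pos hx, if_neg hy]
      simp
  · rw [if_neg (fun hK' => hx (hK.1 hK').2.2), if_neg hx]
    simp

lemma sum_normSq_playRound_attackEquiv {A B T : Type} [Fintype A] [DecidableEq A] [Fintype B]
    [DecidableEq B] [Fintype T] [DecidableEq T] (h : AttackWork B m n ≃ T)
    (C : Circuit (AttackWires ((A ⊕ B) ⊕ (K ⊕ Fin m)) m n)) (k : K → Bool) (φ : QState A E)
    (R : Bits n → Bits n → Prop) [∀ x₀ x₁, Decidable (R x₀ x₁)] :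
    (∑ x₀, ∑ x₁, if R x₀ x₁ then
      normSq (playRound (C.rename (attackEquiv h).toEmbedding) k (Sum.elim x₀ x₁)
        (attachReg φ fun _ : T => false)) else 0) =
      ∑ z, if R (fun i => z (fstReg i)) (fun i => z (sndReg i)) then
        ‖C.run (attackInit k (attachReg φ fun _ : B => false)) z‖ ^ 2 else 0 := by
  have hrun : ∀ z, (C.rename (attackEquiv h).toEmbedding).run
      (attachReg (attachReg φ fun _ : T => false) (Sum.elim k fun _ => false)) z =
      C.run (attackInit k (attachReg φ fun _ : B => false)) (z ∘ attackEquiv h) := by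
    intro z
    rw [Circuit.run_rename_equiv]
    congr 1
    funext u
    exact attachReg_attackEquiv h k φ u
  rw [← Equiv.sum_comp (Equiv.arrowCongr (attackEquiv h) (Equiv.refl Bool)).symm]
  have hnorm : ∀ x₀ x₁, normSq (playRound (C.rename (attackEquiv h).toEmbedding) k (Sum.elim x₀ x₁)
        (attachReg φ fun _ : T => false)) = ∑ z : (A ⊕ T) ⊕ (K ⊕ (Fin n ⊕ Fin n)) → Bool,
      if (fun i => z (.inr (.inr (.inl i)))) = x₀ ∧ (fun i => z (.inr (.inr (.inr i)))) = x₁ then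
        ‖C.run (attackInit k (attachReg φ fun _ : B => false)) (z ∘ attackEquiv h)‖ ^ 2 else 0 := by
    intro x₀ x₁
    refine Finset.sum_congr rfl fun z _ => ?_
    rw [playRound, hrun]
    have : ((fun b => z (Sum.inr (Sum.inr b))) = Sum.elim x₀ x₁) ↔
        (fun i => z (.inr (.inr (.inl i)))) = x₀ ∧ (fun i => z (.inr (.inr (.inr i)))) = x₁ := by
      simp only [funext_iff, Sum.forall, Sum.elim_inl, Sum.elim_inr]
    simp only [this]
    split_ifs <;> simp
  simp only [hnorm]
  have hswap : ∀ x₀ x₁ (G : ((A ⊕ T) ⊕ (K ⊕ (Fin n ⊕ Fin n)) → Bool) → ℝ),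
      (if R x₀ x₁ then ∑ z, G z else 0) = ∑ z, if R x₀ x₁ then G z else 0 := by
    intro x₀ x₁ G; split_ifs <;> simp
  simp only [hswap]
  rw [Finset.sum_congr rfl fun x₀ _ => Finset.sum_comm, Finset.sum_comm]
  refine Finset.sum_congr rfl fun z _ => ?_
  rw [Finset.sum_eq_single (fun i => z (.inr (.inr (.inl i)))),
    Finset.sum_eq_single (fun i => z (.inr (.inr (.inr i))))]
  · simp only [and_self, if_true]
    rfl
  · intro x₁ _ hx
    simp [Ne.symm hx]
  · simp
  · intro x₀ _ hx
    simp [Ne.symm hx]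
  · simp

end ClawFinder

/-! ## Asymptotics -/

lemma PolyBounded.mono {f g : ℕ → ℕ} (hg : PolyBounded g) (h : ∀ l, f l ≤ g l) :
    PolyBounded f := by
  obtain ⟨p, hp⟩ := hg
  exact ⟨p, fun l => (h l).trans (hp l)⟩

lemma PolyBounded.add {f g : ℕ → ℕ} (hf : PolyBounded f) (hg : PolyBounded g) :
    PolyBounded (fun l => f l + g l) := by
  obtain ⟨p, hp⟩ := hf
  obtain ⟨q, hq⟩ := hg
  exact ⟨p + q, fun l => by simpa using add_le_add (hp l) (hq l)⟩

lemma PolyBounded.const_mul {f : ℕ → ℕ} (hf : PolyBounded f) (c : ℕ) :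
    PolyBounded (fun l => c * f l) := by
  obtain ⟨p, hp⟩ := hf
  exact ⟨Polynomial.C c * p, fun l => by simpa using Nat.mul_le_mul_left c (hp l)⟩

lemma polyBounded_const (c : ℕ) : PolyBounded (fun _ => c) := ⟨Polynomial.C c, fun l => by simp⟩

/-- To beat `l ^ j` after the square root, use that `ν` beats `l ^ (2 * j)`. -/
lemma Negligible.const_mul_sqrt {ν : ℕ → ℝ} (hν : Negligible ν) {c : ℝ} (hc : 0 ≤ c) :
    Negligible (fun l => c * √(ν l)) := by
  refine ⟨fun l => by positivity, Asymptotics.SuperpolynomialDecay.const_mul ?_ c⟩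
  intro j
  have h := (hν.2 (2 * j)).sqrt
  rw [Real.sqrt_zero] at h
  refine h.congr fun l => ?_
  rw [Real.sqrt_mul (by positivity), mul_comm 2 j, pow_mul, Real.sqrt_sq (by positivity)]

/-- Jensen's inequality for the square root, obtained from Cauchy-Schwarz. -/
lemma expect_sqrt_le {ι : Type} [Fintype ι] [Nonempty ι] (f : ι → ℝ) (hf : ∀ i, 0 ≤ f i) :
    𝔼 i, √(f i) ≤ √(𝔼 i, f i) := by
  refine Real.le_sqrt_of_sq_le ?_
  rw [Fintype.expect_eq_sum_div_card, Fintype.expect_eq_sum_div_card, div_pow]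
  have hcard : (0 : ℝ) < Fintype.card ι := by exact_mod_cast Fintype.card_pos
  have h := sq_sum_le_card_mul_sum_sq (s := Finset.univ) (f := fun i => √(f i))
  simp only [Real.sq_sqrt (hf _), Finset.card_univ] at h
  rw [div_le_div_iff₀ (by positivity) hcard]
  nlinarith

/-! ## Soundness -/

namespace TCFData

variable {F : TCFData}

/-- If inversion succeeds then `y` has a preimage; the matched pair containing it is a claw, and
inversion at `y` returns exactly that pair. -/
lemma InjectivePairs.claw (hF : F.InjectivePairs) (l : ℕ) (ω : Bits (F.coinLen l))
    (y : Bits (F.yLen l)) (p : Bits (F.n l) × Bits (F.n l))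
    (hp : F.inv l (F.gen l ω).2 y = some p) :
    F.IsClaw l (F.gen l ω).1 p.1 p.2 ∧ F.IsClaw l (F.gen l ω).1 p.2 p.1 := by
  obtain ⟨R, hR, hclaw, hnone⟩ := hF l ω
  have hy : ∃ x ∈ F.X l (F.gen l ω).1, F.f l (F.gen l ω).1 x = y := by
    by_contra! h
    rw [hnone y h] at hp
    exact Option.some_ne_none _ hp.symm
  obtain ⟨x, hx, rfl⟩ := hy
  obtain ⟨p', ⟨hp'R, hp'x⟩, -⟩ := hR.2 x hx
  obtain ⟨heq, hinv⟩ := hclaw p' hp'R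
  have hfx : F.f l (F.gen l ω).1 p'.1 = F.f l (F.gen l ω).1 x := by
    rcases hp'x with h | h
    · rw [h]
    · rw [heq, h]
  rw [hfx, hp, Option.some_inj] at hinv
  subst hinv
  obtain ⟨h1, h2, h3⟩ := hR.1 p hp'R
  exact ⟨⟨h1, h2, h3, heq⟩, ⟨h2, h1, h3.symm, heq.symm⟩⟩

namespace Prover

variable {S : InitialState} (P : F.Prover S)

/-- The workspace of the claw finder. -/
def clawWork (l : ℕ) : ℕ := P.work l + (2 * F.yLen l + 3 * F.n l + 2)

/-- An enumeration of the workspace of the claw finder. -/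
def workEquiv (l : ℕ) : AttackWork (Fin (P.work l)) (F.yLen l) (F.n l) ≃ Fin (P.clawWork l) :=
  Fintype.equivFinOfCardEq (by simp [clawWork]; ring)

/-- The adversary against claw-freeness obtained from a prover. -/
def clawFinder : F.ClawFinder S where
  work := P.clawWork
  circuit l := Circuit.rename (attackEquiv (P.workEquiv l)).toEmbedding
    (clawCircuit (P.commit l) (P.equation l) (P.answer l) (P.preimage l))

lemma clawFinder_isPoly (hF : F.PolyLengths) (hP : P.IsPoly) : P.clawFinder.IsPoly := by
  obtain ⟨-, -, -, hn, hy⟩ := hF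
  obtain ⟨hw, hc, hp, he, ha⟩ := hP
  refine ⟨hw.add (((hy.const_mul 2).add (hn.const_mul 3)).add (polyBounded_const 2)), ?_⟩
  refine PolyBounded.mono ((((((hc.add hy).add (hn.const_mul 7)).add (he.const_mul 2)).add
    (ha.const_mul 4)).add hp).add (polyBounded_const 12)) fun l => ?_
  refine le_trans (le_of_eq (Circuit.length_rename _ _)) ?_
  exact length_clawCircuit_le _ _ _ _

lemma sum_normSq_stateY (l : ℕ) (k : Bits (F.keyLen l)) : ∑ y, normSq (P.stateY l k y) = 1 := by
  refine (sum_normSq_playRound _ _ _).trans ?_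
  rw [← S.norm_one l]
  exact normSq_attachReg _ _

/-! ### Bounds for a fixed key -/

/-- The exclusive or of the claw of `y`. -/
def clawXor (_ : F.Prover S) (l : ℕ) (ω : Bits (F.coinLen l)) (y : Bits (F.yLen l)) : Bits (F.n l) :=
  -- The default is harmless: commitments without a claw are excluded by the predicate `g` of
  -- `sum_correlation_le`.
  (F.inv l (F.gen l ω).2 y).elim (fun _ => false) fun p => p.1.xor p.2

open Classical in
/-- The probability that the claw finder succeeds on a given key. -/
def clawProb (l : ℕ) (ω : Bits (F.coinLen l)) : ℝ :=
  ∑ x₀ : Bits (F.n l), ∑ x₁ : Bits (F.n l),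
    if F.IsClaw l (F.gen l ω).1 x₀ x₁ then
      normSq (playRound (P.clawFinder.circuit l) (F.gen l ω).1 (Sum.elim x₀ x₁)
        (S.memory P.clawFinder.work l))
    else 0

open Classical in
/-- The acceptance probability in the preimage test on a given key. -/
def preimageProbKey (l : ℕ) (ω : Bits (F.coinLen l)) : ℝ :=
  ∑ y : Bits (F.yLen l), ∑ x : Bits (F.n l),
    if preimageAccepts (F.inv l (F.gen l ω).2 y) x then P.probYX l (F.gen l ω).1 y x else 0

open Classical in
/-- The acceptance probability in the equation test on a given key. -/
def equationProbKey (l : ℕ) (ω : Bits (F.coinLen l)) : ℝ :=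
  𝔼 r : Bits (F.n l), 𝔼 m : Bool, ∑ y : Bits (F.yLen l), ∑ d : Bits (F.n l), ∑ b : Bool,
      if equationAccepts (F.inv l (F.gen l ω).2 y) r d m b then
        P.probYDB l (F.gen l ω).1 r m y d b
      else 0

lemma clawProb_nonneg (l : ℕ) (ω : Bits (F.coinLen l)) : 0 ≤ P.clawProb l ω := by
  refine Finset.sum_nonneg fun _ _ => Finset.sum_nonneg fun _ _ => ?_
  split_ifs
  · exact normSq_nonneg _
  · exact le_rfl

open Classical in
-- Whichever of `x₀`, `x₁` the accepted preimage is, adding `x₀ ⊕ x₁` to it gives the other one, so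
-- the pair output by the finder is a claw in one of its two orders.
lemma attack_le_clawProb (hF : F.InjectivePairs) (l : ℕ) (ω : Bits (F.coinLen l)) :
    (∑ z, if (F.inv l (F.gen l ω).2 (fun i => z (AttackWires.yReg i))).isSome ∧
        preimageAccepts (F.inv l (F.gen l ω).2 (fun i => z (AttackWires.yReg i)))
          (fun i => z (AttackWires.fstReg i)) ∧
        (fun i => z (AttackWires.sndReg i)) = P.clawXor l ω (fun i => z (AttackWires.yReg i)) then
      ‖(attackCircuit (P.equation l) (P.answer l) (P.preimage l)).run
        (attackState fun y x => if x = (fun _ => false) then P.stateY l (F.gen l ω).1 y else 0) z‖ ^ 2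
      else 0) ≤ P.clawProb l ω := by
  have h := (sum_normSq_playRound_attackEquiv (P.workEquiv l)
    (clawCircuit (P.commit l) (P.equation l) (P.answer l) (P.preimage l)) (F.gen l ω).1
    (S.state l) (F.IsClaw l (F.gen l ω).1)).trans (run_clawCircuit_sum (P.commit l) (P.equation l)
      (P.answer l) (P.preimage l) (F.gen l ω).1 _ (F.IsClaw l (F.gen l ω).1))
  refine le_trans ?_ (le_of_eq h.symm)
  refine Finset.sum_le_sum fun z _ => ?_
  split_ifs with h1 h2
  · exact le_rfl
  · exfalso
    apply h2
    obtain ⟨hsome, hacc, hx⟩ := h1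
    obtain ⟨p, hp⟩ := Option.isSome_iff_exists.1 hsome
    obtain ⟨hc1, hc2⟩ := hF.claw l ω _ p hp
    rw [clawXor, hp] at hx
    rw [hp] at hacc
    have hx' : ∀ i, z (AttackWires.sndReg i) = (p.1 i ^^ p.2 i) := fun i => congrFun hx i
    rcases hacc with ho | ho
    · have ho' : ∀ i, z (AttackWires.fstReg i) = p.1 i := fun i => congrFun ho i
      convert hc1 using 1
      funext i
      rw [hx', ho', Bool.xor_right_comm]
      simp
    · have ho' : ∀ i, z (AttackWires.fstReg i) = p.2 i := fun i => congrFun ho i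
      convert hc2 using 1
      funext i
      rw [hx', ho', Bool.xor_assoc]
      simp
  · positivity
  · exact le_rfl

open Classical in
-- An inequality, since commitments without a claw also make the preimage test fail but are not
-- counted on the left.
lemma sum_rejected_le (l : ℕ) (ω : Bits (F.coinLen l)) :
    (∑ y, if (F.inv l (F.gen l ω).2 y).isSome then
      ∑ o, if preimageAccepts (F.inv l (F.gen l ω).2 y) o then 0 else
        P.probYX l (F.gen l ω).1 y o else 0) ≤ 1 - P.preimageProbKey l ω := by
  rw [le_sub_iff_add_le, preimageProbKey, ← Finset.sum_add_distrib,
    ← P.sum_normSq_stateY l (F.gen l ω).1]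
  refine Finset.sum_le_sum fun y _ => ?_
  have hsum : ∑ o, P.probYX l (F.gen l ω).1 y o = normSq (P.stateY l (F.gen l ω).1 y) :=
    sum_normSq_playRound _ _ _
  cases hinv : F.inv l (F.gen l ω).2 y with
  | none =>
    simpa [preimageAccepts] using normSq_nonneg (P.stateY l (F.gen l ω).1 y)
  | some p =>
    rw [← hsum]
    simp only [Option.isSome_some, if_true]
    rw [← Finset.sum_add_distrib]
    refine Finset.sum_le_sum fun o _ => ?_
    split_ifs <;> simp

open Classical in
-- Sum `equation_score_le` over `y` and `d` and average over `r`: the main terms add up to total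
-- probability one, and the correlation terms form the Fourier sum bounded by `sum_correlation_le`.
-- Where inversion fails the verifier rejects, and the bound is trivial.
lemma equationProbKey_le (hF : F.InjectivePairs) (l : ℕ) (ω : Bits (F.coinLen l)) :
    P.equationProbKey l ω ≤ 1 / 2 + √2 / 4 +
      √2 / 8 * (√(P.clawProb l ω) + √(1 - P.preimageProbKey l ω)) := by
  have key := sum_correlation_le (P.equation l) (P.answer l) (P.preimage l)
    (P.stateY l (F.gen l ω).1) (P.sum_normSq_stateY l _) (P.clawXor l ω)
    (fun y => (F.inv l (F.gen l ω).2 y).isSome)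
    (fun y => preimageAccepts (F.inv l (F.gen l ω).2 y))
  have key' := key.trans (add_le_add (Real.sqrt_le_sqrt (P.attack_le_clawProb hF l ω))
    (Real.sqrt_le_sqrt (P.sum_rejected_le l ω)))
  refine le_trans ?_ (add_le_add_right (mul_le_mul_of_nonneg_left key' (by positivity)) _)
  have hswap : P.equationProbKey l ω = ∑ y, 𝔼 r : Bits (F.n l), ∑ d : Bits (F.n l), 𝔼 m : Bool,
      ∑ b : Bool, if equationAccepts (F.inv l (F.gen l ω).2 y) r d m b then
        P.probYDB l (F.gen l ω).1 r m y d b else 0 := by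
    simp only [equationProbKey, Finset.expect_sum_comm]
  rw [hswap]
  have hc : (0 : ℝ) ≤ 1 / 2 + √2 / 4 := by positivity
  have hy : ∀ y, (𝔼 r : Bits (F.n l), ∑ d : Bits (F.n l), 𝔼 m : Bool,
      ∑ b : Bool, if equationAccepts (F.inv l (F.gen l ω).2 y) r d m b then
        P.probYDB l (F.gen l ω).1 r m y d b else 0) ≤
      (1 / 2 + √2 / 4) * normSq (P.stateY l (F.gen l ω).1 y) +
        √2 / 8 * (if (F.inv l (F.gen l ω).2 y).isSome then 𝔼 r : Bits (F.n l), ∑ d,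
          (dotSign r (P.clawXor l ω y)).re *
            correlation (P.answer l) (playRound (P.equation l) r d (P.stateY l (F.gen l ω).1 y))
          else 0) := by
    intro y
    cases hinv : F.inv l (F.gen l ω).2 y with
    | none =>
      simpa [equationAccepts] using mul_nonneg hc (normSq_nonneg (P.stateY l (F.gen l ω).1 y))
    | some p =>
      simp only [Option.isSome_some, if_true, clawXor, hinv, Option.elim_some]
      have hr : ∀ r, (∑ d : Bits (F.n l), 𝔼 m : Bool,
          ∑ b : Bool, if equationAccepts (some p) r d m b then
            P.probYDB l (F.gen l ω).1 r m y d b else 0) ≤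
          (1 / 2 + √2 / 4) * normSq (P.stateY l (F.gen l ω).1 y) +
            √2 / 8 * ∑ d, (dotSign r (p.1.xor p.2)).re *
              correlation (P.answer l)
                (playRound (P.equation l) r d (P.stateY l (F.gen l ω).1 y)) := by
        intro r
        refine (Finset.sum_le_sum fun d _ => equation_score_le p r d (P.answer l)
          (playRound (P.equation l) r d (P.stateY l (F.gen l ω).1 y))).trans (le_of_eq ?_)
        rw [Finset.sum_add_distrib, ← Finset.mul_sum, ← Finset.mul_sum, sum_normSq_playRound]
      refine (Finset.expect_le_expect fun r _ => hr r).trans (le_of_eq ?_)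
      rw [Finset.expect_add_distrib, Finset.expect_const Finset.univ_nonempty, Finset.mul_expect]
  refine (Finset.sum_le_sum fun y _ => hy y).trans (le_of_eq ?_)
  rw [Finset.sum_add_distrib, ← Finset.mul_sum, ← Finset.mul_sum, P.sum_normSq_stateY, mul_one]

end Prover

end TCFData

end

theorem theorem3 (F : TCFData) (S : InitialState) (hF : F.IsPostQuantumTCF S)
    (P : F.Prover S) (hP : P.IsPoly)
    (κ q : ℕ → ℝ) (hκ : ∀ l, P.preimageProb l = 1 - κ l) (hq : ∀ l, P.equationProb l = q l) :
    ∃ ν : ℕ → ℝ, Negligible ν ∧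
      ∀ l, q l ≤ Real.cos (Real.pi / 8) ^ 2 + √(κ l) / 2 + ν l := by
  have hsucc := hF.clawFree P.clawFinder (P.clawFinder_isPoly hF.lengths hP)
  -- The witness is `√2 / 8` times the square root of the claw finder's success probability.
  refine ⟨_, hsucc.const_mul_sqrt (c := √2 / 8) (by positivity), fun l => ?_⟩
  -- Nonnegativity for each key is what allows the square root to be averaged over keys.
  have hrej : ∀ ω, 0 ≤ 1 - P.preimageProbKey l ω := by
    intro ω
    refine le_trans ?_ (P.sum_rejected_le l ω)
    refine Finset.sum_nonneg fun y _ => ?_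
    split_ifs
    · refine Finset.sum_nonneg fun o _ => ?_
      split_ifs
      · exact le_rfl
      · exact normSq_nonneg _
    · exact le_rfl
  have hκl : 𝔼 ω, (1 - P.preimageProbKey l ω) = κ l := by
    rw [Finset.expect_sub_distrib, Finset.expect_const Finset.univ_nonempty]
    have : 𝔼 ω, P.preimageProbKey l ω = 1 - κ l := hκ l
    rw [this]
    ring
  have hql : 𝔼 ω, P.equationProbKey l ω = q l := hq l
  have hclaw : 𝔼 ω, P.clawProb l ω = P.clawFinder.successProb l := rfl
  have h := Finset.expect_le_expect fun ω (_ : ω ∈ (Finset.univ : Finset (Bits (F.coinLen l)))) =>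
    P.equationProbKey_le hF.pairs l ω
  rw [hql, Finset.expect_add_distrib, Finset.expect_const Finset.univ_nonempty,
    ← Finset.mul_expect, Finset.expect_add_distrib] at h
  have h1 := expect_sqrt_le _ (P.clawProb_nonneg l)
  have h2 := expect_sqrt_le _ hrej
  rw [hclaw] at h1
  rw [hκl] at h2
  have hcos : Real.cos (Real.pi / 8) ^ 2 = 1 / 2 + √2 / 4 := by
    rw [Real.cos_sq, show 2 * (Real.pi / 8) = Real.pi / 4 by ring, Real.cos_pi_div_four]
    ring
  -- The argument yields the smaller coefficient `√2 / 8`, here weakened to `1 / 2`.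
  have h3 : √2 / 8 * √(κ l) ≤ √(κ l) / 2 := by
    have : √2 ≤ 2 := Real.sqrt_le_iff.2 ⟨by norm_num, by norm_num⟩
    nlinarith [Real.sqrt_nonneg (κ l)]
  have h4 := mul_le_mul_of_nonneg_left (add_le_add h1 h2) (by positivity : 0 ≤ √2 / 8)
  rw [hcos]
  linarith
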